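/- Let $A_0=\begin{pmatrix}1&1\\0&1\end{pmatrix}$, $A_1=\begin{pmatrix}1&0\\1&1\end{pmatrix}$, and for an infinite word $x=(x_i)_{i\ge1}\in\{0,1\}^{\mathbb N}$ and $n\ge1$ put $\mathcal A(x,n)=A_{x_n}\cdots A_{x_2}A_{x_1}$. Let $\|\cdot\|$ be the matrix norm induced by the Euclidean norm on $\mathbb R^2$, let $\rho$ denote the spectral radius, and let $$\varrho(1)=\limsup_{n\to\infty}\max\bigl\{\|A_{i_1}\cdots A_{i_n}\|^{1/n}: i_1,\dots,i_n\in\{0,1\}\bigr\}$$ be the joint spectral radius of $\{A_0,A_1\}$. An infinite word $x$ is recurrent if each finite subword (block of consecutive letters) of $x$ occurs in $x$ infinitely often, and balanced if for any two finite subwords of $x$ of equal length the numbers of letters $1$ in them differ by at most $1$. For $\gamma\in[0,1]$ let $X_\gamma$ be the set of all recurrent balanced infinite words $x$ with $\lim_{n\to\infty}\frac1n\#\{1\le i\le n: x_i=1\}=\gamma$. Then there is a continuous concave function $S\colon[0,1]\to\mathbb R$ with the following properties. 1. For each $\gamma\in[0,1]$, $$\lim_{n\to\infty}\frac1n\log\|\mathcal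 A(x,n)\|=\lim_{n\to\infty}\frac1n\log\rho(\mathcal A(x,n))=S(\gamma),$$ both limits being uniform over $x\in X_\gamma$. 2. If $p,q$ are integers with $q\ge1$ and $0\le p\le q$ (not necessarily coprime), then $S(p/q)=q^{-1}\log\rho(\mathcal A(x,q))$ for every $x\in X_{p/q}$. 3. $S(0)=S(1)=0=\inf_{[0,1]}S$, and $\sup_{[0,1]}S=S(1/2)=\log\frac{1+\sqrt5}{2}=\log\varrho(1)$. 4. $S(\gamma)=S(1-\gamma)$ for all $\gamma\in[0,1]$. 5. $S$ is non-decreasing on $[0,1/2]$. -/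

import Mathlib

namespace BalancedProducts

open Filter

/-- A finite word over the alphabet `{0, 1}`. -/
abbrev FiniteWord := List (Fin 2)

/-- An infinite word over the alphabet `{0, 1}`; `x 0` is the first letter, `x 1` the second. -/
abbrev InfiniteWord := ℕ → Fin 2

/-- The prefix of length `n` of an infinite word. -/
def initialWord (n : ℕ) (x : InfiniteWord) : FiniteWord :=
  List.ofFn fun i : Fin n => x i

/-- The number of letters of `u` equal to `1`. -/
def ones (u : FiniteWord) : ℕ := u.count 1

/-- The 1-ratio of a finite word: the proportion of its letters equal to `1`. -/
noncomputable def oneRatio (u : FiniteWord) : ℝ := (ones u : ℝ) / (u.length : ℝ)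

/-- The finite word `u` occurs in `x` immediately after the first `k` letters of `x`. -/
def OccursAt (u : FiniteWord) (x : InfiniteWord) (k : ℕ) : Prop :=
  ∀ i : Fin u.length, u.get i = x (k + i)

/-- `u` is a (nonempty) subword of the infinite word `x`. -/
def IsSubword (u : FiniteWord) (x : InfiniteWord) : Prop :=
  u ≠ [] ∧ ∃ k, OccursAt u x k

/-- Every finite subword of `x` occurs in `x` infinitely many times. -/
def IsRecurrent (x : InfiniteWord) : Prop :=
  ∀ u, IsSubword u x → {k | OccursAt u x k}.Infinite

/-- Any two subwords of `x` of equal length have numbers of ones which differ by at most `1`. -/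
def IsBalanced (x : InfiniteWord) : Prop :=
  ∀ u v, IsSubword u x → IsSubword v x → u.length = v.length →
    |(ones u : ℤ) - (ones v : ℤ)| ≤ 1

/-- The set `X_γ` of recurrent balanced infinite words whose 1-ratio exists and equals `γ`. -/
def X (γ : ℝ) : Set InfiniteWord :=
  {x | IsRecurrent x ∧ IsBalanced x ∧
    Tendsto (fun n : ℕ => oneRatio (initialWord n x)) atTop (nhds γ)}

/-- The matrix norm induced by the Euclidean norm on `ℝ^d`. -/
noncomputable def euclideanNorm {d : ℕ} (B : Matrix (Fin d) (Fin d) ℝ) : ℝ :=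
  ‖Matrix.toEuclideanCLM (n := Fin d) (𝕜 := ℝ) B‖

/-- The spectral radius of a real matrix: the largest modulus of a complex eigenvalue. -/
noncomputable def specRadius {d : ℕ} (B : Matrix (Fin d) (Fin d) ℝ) : ℝ :=
  (spectralRadius ℂ (B.map (algebraMap ℝ ℂ))).toReal

/-- The joint spectral radius of a finite family of real matrices: the limit superior, as `n` tends
to infinity, of the maximum of `‖A_{i_1} ⋯ A_{i_n}‖ ^ (1 / n)` over all `i_1, …, i_n`. -/
noncomputable def jointSpectralRadius {ι : Type*} [Fintype ι] {d : ℕ}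
    (A : ι → Matrix (Fin d) (Fin d) ℝ) : ℝ :=
  limsup
    (fun n : ℕ => ⨆ i : Fin n → ι,
      euclideanNorm ((List.ofFn i).map A).prod ^ (1 / (n : ℝ))) atTop

/-- The pair of matrices `A_0 = (1 1; 0 1)` and `α A_1 = α (1 0; 1 1)`. -/
noncomputable def matrixPair (α : ℝ) : Fin 2 → Matrix (Fin 2) (Fin 2) ℝ :=
  ![!![1, 1; 0, 1], α • !![1, 0; 1, 1]]

/-- The joint spectral radius `ϱ(α)` of the pair `{A_0, α A_1}`. -/
noncomputable def rhoPair (α : ℝ) : ℝ := jointSpectralRadius (matrixPair α)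

/-- For `u = u_1 u_2 ⋯ u_n`, the product `A_{u_n} ⋯ A_{u_2} A_{u_1}`. -/
noncomputable def wordProduct (u : FiniteWord) : Matrix (Fin 2) (Fin 2) ℝ :=
  (u.reverse.map (matrixPair 1)).prod

/-- `𝒜(x, n) = A_{x_n} ⋯ A_{x_2} A_{x_1}`. -/
noncomputable def cocycle (x : InfiniteWord) (n : ℕ) : Matrix (Fin 2) (Fin 2) ℝ :=
  wordProduct (initialWord n x)

end BalancedProducts

namespace BalancedProducts

open Filter

/-! ### Matrices of finite words -/

/-! Take S to be `growth`, the infimum of all affine functions a t + b such that the log of the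
trace of a word's product is at most a·(ones) + b·(length) + O(1). An infimum of affine functions is
concave, and exchanging the two letters permutes the majorants, so S is symmetric. Monotonicity on
the left half follows. Explicit majorants give the behaviour at the endpoints (`isMajorant_weight`)
and the bound by the log of the golden ratio (`isMajorant_golden`), attained at 1/2 by the word 01.
A word in `X γ` has discrepancy at most 1, so each majorant bounds its growth uniformly from above.

The work lies in showing that nothing is lost on balanced words. The combinatorial core is
`trace_lt_trace_exchange`: a shortest imbalance in a periodic word yields disjoint factors 0p0 and
1p1 with p a palindrome, and an exchange then strictly increases the trace. Hence a trace maximizer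
with prescribed length and number of ones extends periodically to a balanced word. That word is
unique up to rotation, because balanced recurrent words of rational slope are shifts of mechanical
words (`eq_shift_mech`).

At p/q, arbitrary words joined by the connector 01 can be mixed to have slope exactly p/q. Their
traces are then controlled by powers of the balanced period. A one-dimensional separation argument
(`exists_slope`) turns this into a majorant touching the desired value (`growth_eq_of_mem_X`).

For irrational γ, every block of length q - 1 of a word of slope γ is a factor of the mechanical
word of slope p/q, for a suitable approximant p/q with q large. Chaining such blocks through short
connectors containing both letters, and using continuity of S, gives the uniform lower bound
(`le_log_specRadius_cocycle`). -/

lemma matrixPair_one_zero : matrixPair 1 0 = !![1, 1; 0, 1] := rfl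

lemma matrixPair_one_one : matrixPair 1 1 = !![1, 0; 1, 1] := by
  simp [matrixPair]

lemma wordProduct_nil : wordProduct [] = 1 := by simp [wordProduct]

lemma wordProduct_append (u v : FiniteWord) :
    wordProduct (u ++ v) = wordProduct v * wordProduct u := by
  simp [wordProduct]

lemma wordProduct_singleton (a : Fin 2) : wordProduct [a] = matrixPair 1 a := by
  simp [wordProduct]

lemma wordProduct_cons (a : Fin 2) (u : FiniteWord) :
    wordProduct (a :: u) = wordProduct u * matrixPair 1 a := by
  simp [wordProduct]

lemma wordProduct_flatten_replicate (u : FiniteWord) (n : ℕ) :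
    wordProduct (List.replicate n u).flatten = wordProduct u ^ n := by
  induction n with
  | zero => simp [wordProduct_nil]
  | succ n ih => rw [List.replicate_succ, List.flatten_cons, wordProduct_append, ih, pow_succ]

/-- The sum of the entries of a `2 × 2` matrix. -/
noncomputable def entrySum (B : Matrix (Fin 2) (Fin 2) ℝ) : ℝ :=
  B 0 0 + B 0 1 + B 1 0 + B 1 1

/-- Nonnegative matrices dominating the identity entrywise. -/
structure DominatesOne (B : Matrix (Fin 2) (Fin 2) ℝ) : Prop where
  h00 : 1 ≤ B 0 0
  h01 : 0 ≤ B 0 1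
  h10 : 0 ≤ B 1 0
  h11 : 1 ≤ B 1 1

lemma DominatesOne.one : DominatesOne 1 := by constructor <;> simp

lemma DominatesOne.mul {B C : Matrix (Fin 2) (Fin 2) ℝ} (hB : DominatesOne B)
    (hC : DominatesOne C) : DominatesOne (B * C) := by
  obtain ⟨b1, b2, b3, b4⟩ := hB
  obtain ⟨c1, c2, c3, c4⟩ := hC
  constructor <;> simp only [Matrix.mul_apply, Fin.sum_univ_two]
  · nlinarith [mul_nonneg b2 c3]
  · nlinarith [mul_nonneg b2 (sub_nonneg.2 c4), mul_nonneg c2 (sub_nonneg.2 b1)]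
  · nlinarith [mul_nonneg b3 (sub_nonneg.2 c1), mul_nonneg c3 (sub_nonneg.2 b4)]
  · nlinarith [mul_nonneg b3 c2]

lemma dominatesOne_matrixPair (a : Fin 2) : DominatesOne (matrixPair 1 a) := by
  fin_cases a
  · constructor <;> simp [matrixPair_one_zero]
  · constructor <;> simp [matrixPair_one_one]

lemma dominatesOne_wordProduct (u : FiniteWord) : DominatesOne (wordProduct u) := by
  induction u with
  | nil => rw [wordProduct_nil]; exact .one
  | cons a u ih => rw [wordProduct_cons]; exact ih.mul (dominatesOne_matrixPair a)

lemma det_wordProduct (u : FiniteWord) : (wordProduct u).det = 1 := by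
  induction u with
  | nil => simp [wordProduct_nil]
  | cons a u ih =>
    rw [wordProduct_cons, Matrix.det_mul, ih]
    fin_cases a
    · simp [matrixPair_one_zero]
    · simp [matrixPair_one_one]

lemma DominatesOne.one_le_entrySum {B : Matrix (Fin 2) (Fin 2) ℝ} (hB : DominatesOne B) :
    1 ≤ entrySum B := by
  obtain ⟨b1, b2, b3, b4⟩ := hB
  unfold entrySum; linarith

lemma DominatesOne.two_le_trace {B : Matrix (Fin 2) (Fin 2) ℝ} (hB : DominatesOne B) :
    2 ≤ B.trace := by
  obtain ⟨b1, b2, b3, b4⟩ := hB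
  rw [Matrix.trace_fin_two]; linarith

lemma DominatesOne.trace_le_entrySum {B : Matrix (Fin 2) (Fin 2) ℝ} (hB : DominatesOne B) :
    B.trace ≤ entrySum B := by
  obtain ⟨b1, b2, b3, b4⟩ := hB
  rw [Matrix.trace_fin_two, entrySum]; linarith

lemma DominatesOne.trace_le_trace_mul {B C : Matrix (Fin 2) (Fin 2) ℝ} (hB : DominatesOne B)
    (hC : DominatesOne C) : C.trace ≤ (B * C).trace := by
  obtain ⟨b1, b2, b3, b4⟩ := hB
  obtain ⟨c1, c2, c3, c4⟩ := hC
  simp only [Matrix.trace_fin_two, Matrix.mul_apply, Fin.sum_univ_two]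
  nlinarith [mul_nonneg b2 c3, mul_nonneg b3 c2]

/-- Inserting a matrix all of whose entries are at least `1`. -/
lemma DominatesOne.entrySum_mul_entrySum_le {V C U : Matrix (Fin 2) (Fin 2) ℝ}
    (hV : DominatesOne V) (hU : DominatesOne U) (hC : ∀ i j, 1 ≤ C i j) :
    entrySum V * entrySum U ≤ entrySum (V * C * U) := by
  obtain ⟨v1, v2, v3, v4⟩ := hV
  obtain ⟨u1, u2, u3, u4⟩ := hU
  have h1 := sub_nonneg.2 (hC 0 0)
  have h2 := sub_nonneg.2 (hC 0 1)
  have h3 := sub_nonneg.2 (hC 1 0)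
  have h4 := sub_nonneg.2 (hC 1 1)
  have e : entrySum (V * C * U) - entrySum V * entrySum U =
      (V 0 0 + V 1 0) * (C 0 0 - 1) * (U 0 0 + U 0 1) +
      (V 0 0 + V 1 0) * (C 0 1 - 1) * (U 1 0 + U 1 1) +
      (V 0 1 + V 1 1) * (C 1 0 - 1) * (U 0 0 + U 0 1) +
      (V 0 1 + V 1 1) * (C 1 1 - 1) * (U 1 0 + U 1 1) := by
    simp only [entrySum, Matrix.mul_apply, Fin.sum_univ_two]; ring
  have : 0 ≤ entrySum (V * C * U) - entrySum V * entrySum U := by rw [e]; positivity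
  linarith

/-- Each entry of V appears in the trace multiplied by the transposed entry of C, which is at least
1. A factor containing both letters thus converts entry sums into traces. -/
lemma DominatesOne.entrySum_le_trace_mul {V C : Matrix (Fin 2) (Fin 2) ℝ}
    (hV : DominatesOne V) (hC : ∀ i j, 1 ≤ C i j) : entrySum V ≤ (V * C).trace := by
  obtain ⟨v1, v2, v3, v4⟩ := hV
  have h1 := sub_nonneg.2 (hC 0 0)
  have h2 := sub_nonneg.2 (hC 0 1)
  have h3 := sub_nonneg.2 (hC 1 0)
  have h4 := sub_nonneg.2 (hC 1 1)
  have e : (V * C).trace - entrySum V =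
      V 0 0 * (C 0 0 - 1) + V 0 1 * (C 1 0 - 1) + V 1 0 * (C 0 1 - 1) + V 1 1 * (C 1 1 - 1) := by
    simp only [entrySum, Matrix.trace_fin_two, Matrix.mul_apply, Fin.sum_univ_two]; ring
  have : 0 ≤ (V * C).trace - entrySum V := by rw [e]; positivity
  linarith

/-- Left multiplication by a generator adds one row to the other. This bounds the loss from deleting
the last letter of a period. -/
lemma entrySum_wordProduct_append_singleton_le (u : FiniteWord) (a : Fin 2) :
    entrySum (wordProduct (u ++ [a])) ≤ 2 * entrySum (wordProduct u) := by
  rw [wordProduct_append, wordProduct_singleton]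
  obtain ⟨b1, b2, b3, b4⟩ := dominatesOne_wordProduct u
  fin_cases a
  · simp [matrixPair_one_zero, entrySum, Matrix.mul_apply, Fin.sum_univ_two]; linarith
  · simp [matrixPair_one_one, entrySum, Matrix.mul_apply, Fin.sum_univ_two]; linarith

/-- A word containing both letters has a matrix with all entries at least `1`. -/
lemma one_le_wordProduct_of_mem {u : FiniteWord} (h0 : 0 ∈ u) (h1 : 1 ∈ u) (i j : Fin 2) :
    1 ≤ wordProduct u i j := by
  have k0 : ∀ v : FiniteWord, (0 : Fin 2) ∈ v → 1 ≤ wordProduct v 0 1 := by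
    intro v
    induction v with
    | nil => simp
    | cons a v ih =>
      intro h
      obtain ⟨b1, b2, b3, b4⟩ := dominatesOne_wordProduct v
      rw [wordProduct_cons]
      fin_cases a
      · simp [matrixPair_one_zero, Matrix.mul_apply, Fin.sum_univ_two]; linarith
      · have := ih (by simpa using h)
        simpa [matrixPair_one_one, Matrix.mul_apply, Fin.sum_univ_two] using this
  have k1 : ∀ v : FiniteWord, (1 : Fin 2) ∈ v → 1 ≤ wordProduct v 1 0 := by
    intro v
    induction v with
    | nil => simp
    | cons a v ih =>
      intro h
      obtain ⟨b1, b2, b3, b4⟩ := dominatesOne_wordProduct v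
      rw [wordProduct_cons]
      fin_cases a
      · have := ih (by simpa using h)
        simpa [matrixPair_one_zero, Matrix.mul_apply, Fin.sum_univ_two] using this
      · simp [matrixPair_one_one, Matrix.mul_apply, Fin.sum_univ_two]; linarith
  obtain ⟨b1, b2, b3, b4⟩ := dominatesOne_wordProduct u
  fin_cases i <;> fin_cases j
  · exact b1
  · exact k0 u h0
  · exact k1 u h1
  · exact b4

lemma wordProduct_zero_one_ge (i j : Fin 2) : 1 ≤ wordProduct [0, 1] i j :=
  one_le_wordProduct_of_mem (by simp) (by simp) i j

/-! ### Spectral radius -/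

/-- With determinant 1, the characteristic polynomial factors as (z - l)(z - 1/l). -/
lemma specRadius_of_add_inv_eq_trace {B : Matrix (Fin 2) (Fin 2) ℝ} (hdet : B.det = 1) {l : ℝ}
    (hl : 1 ≤ l) (htr : l + l⁻¹ = B.trace) : specRadius B = l := by
  have hl0 : (l : ℂ) ≠ 0 := by exact_mod_cast (by linarith : l ≠ 0)
  set M := B.map (algebraMap ℝ ℂ) with hM
  have hMdet : M.det = 1 := by
    have := (RingHom.map_det (algebraMap ℝ ℂ) B).symm
    rw [hdet] at this; simpa [hM] using this
  have hMtr : M.trace = l + (l : ℂ)⁻¹ := by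
    have : M.trace = ((B.trace : ℝ) : ℂ) := by simp [hM, Matrix.trace_fin_two]
    rw [this, ← htr]; push_cast; rfl
  have hspec : spectrum ℂ M = {(l : ℂ), (l : ℂ)⁻¹} := by
    ext z
    rw [Matrix.mem_spectrum_iff_isRoot_charpoly, Matrix.charpoly_fin_two, hMdet, hMtr]
    simp only [Polynomial.IsRoot.def, Polynomial.eval_add, Polynomial.eval_sub,
      Polynomial.eval_mul, Polynomial.eval_pow, Polynomial.eval_X, Polynomial.eval_C,
      Set.mem_insert_iff, Set.mem_singleton_iff]
    have : z ^ 2 - ((l : ℂ) + (l : ℂ)⁻¹) * z + 1 = (z - l) * (z - (l : ℂ)⁻¹) := by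
      field_simp; ring
    rw [this, mul_eq_zero, sub_eq_zero, sub_eq_zero]
  have hinv : l⁻¹ ≤ 1 := inv_le_one_of_one_le₀ hl
  have hinv0 : 0 < l⁻¹ := by positivity
  rw [specRadius, spectralRadius, hspec]
  rw [iSup_insert, iSup_singleton]
  rw [sup_eq_left.2]
  · simp; linarith
  · simp only [ENNReal.coe_le_coe]
    rw [← NNReal.coe_le_coe]
    simp only [coe_nnnorm, norm_inv, Complex.norm_real, Real.norm_eq_abs]
    rw [abs_of_nonneg (by linarith)]; linarith

/-- By Cayley–Hamilton the traces of the powers satisfy a two-term recurrence with roots l and 1/l.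
-/
lemma trace_pow_of_add_inv_eq_trace {B : Matrix (Fin 2) (Fin 2) ℝ} (hdet : B.det = 1) {l : ℝ}
    (hl : 1 ≤ l) (htr : l + l⁻¹ = B.trace) (n : ℕ) : (B ^ n).trace = l ^ n + l⁻¹ ^ n := by
  have hl0 : l ≠ 0 := by linarith
  have hch : ∀ n, (B ^ (n + 2)).trace = B.trace * (B ^ (n + 1)).trace - (B ^ n).trace := by
    intro n
    have h2 : B ^ 2 = B.trace • B - 1 := by
      have hd := hdet
      rw [Matrix.det_fin_two] at hd
      ext i j
      fin_cases i <;> fin_cases j <;>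
        simp [pow_two, Matrix.mul_apply, Fin.sum_univ_two, Matrix.trace_fin_two] <;> linarith
    rw [pow_add, h2, mul_sub, mul_one, Matrix.mul_smul, ← pow_succ, Matrix.trace_sub,
      Matrix.trace_smul, smul_eq_mul]
  induction n using Nat.twoStepInduction with
  | zero => simp; norm_num
  | one => simpa using htr.symm
  | more n h0 h1 =>
    rw [hch, h0, h1, ← htr]
    linear_combination (l ^ n + l⁻¹ ^ n) * mul_inv_cancel₀ hl0

lemma exists_one_le_add_inv_eq {t : ℝ} (ht : 2 ≤ t) : ∃ l : ℝ, 1 ≤ l ∧ l + l⁻¹ = t := by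
  have hs : 0 ≤ t ^ 2 - 4 := by nlinarith
  refine ⟨(t + √(t ^ 2 - 4)) / 2, by linarith [Real.sqrt_nonneg (t ^ 2 - 4)], ?_⟩
  have h := Real.sq_sqrt hs
  have hpos : 0 < t + √(t ^ 2 - 4) := by linarith [Real.sqrt_nonneg (t ^ 2 - 4)]
  field_simp
  nlinarith

section
variable (u : FiniteWord)

lemma exists_specRadius_wordProduct : 1 ≤ specRadius (wordProduct u) ∧
    ∀ n, (wordProduct u ^ n).trace =
      specRadius (wordProduct u) ^ n + (specRadius (wordProduct u))⁻¹ ^ n := by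
  obtain ⟨l, hl, hlt⟩ := exists_one_le_add_inv_eq (dominatesOne_wordProduct u).two_le_trace
  rw [specRadius_of_add_inv_eq_trace (det_wordProduct u) hl hlt]
  exact ⟨hl, trace_pow_of_add_inv_eq_trace (det_wordProduct u) hl hlt⟩

lemma one_le_specRadius_wordProduct : 1 ≤ specRadius (wordProduct u) :=
  (exists_specRadius_wordProduct u).1

lemma specRadius_pow_le_trace (n : ℕ) :
    specRadius (wordProduct u) ^ n ≤ (wordProduct u ^ n).trace := by
  obtain ⟨h1, h2⟩ := exists_specRadius_wordProduct u
  rw [h2]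
  have : 0 ≤ (specRadius (wordProduct u))⁻¹ ^ n := by positivity
  linarith

lemma trace_pow_le_two_mul_specRadius_pow (n : ℕ) :
    (wordProduct u ^ n).trace ≤ 2 * specRadius (wordProduct u) ^ n := by
  obtain ⟨h1, h2⟩ := exists_specRadius_wordProduct u
  rw [h2]
  have k1 : (specRadius (wordProduct u))⁻¹ ^ n ≤ 1 :=
    pow_le_one₀ (by positivity) (inv_le_one_of_one_le₀ h1)
  have k2 : 1 ≤ specRadius (wordProduct u) ^ n := one_le_pow₀ h1
  linarith

lemma specRadius_le_trace : specRadius (wordProduct u) ≤ (wordProduct u).trace := by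
  simpa using specRadius_pow_le_trace u 1

lemma trace_le_two_mul_specRadius :
    (wordProduct u).trace ≤ 2 * specRadius (wordProduct u) := by
  simpa using trace_pow_le_two_mul_specRadius_pow u 1

end

/-! ### Euclidean norm -/

lemma abs_entry_le_euclideanNorm (B : Matrix (Fin 2) (Fin 2) ℝ) (i j : Fin 2) :
    |B i j| ≤ euclideanNorm B := by
  have h := (Matrix.toEuclideanCLM (n := Fin 2) (𝕜 := ℝ) B).le_opNorm
    (EuclideanSpace.single j (1 : ℝ))
  have h2 := PiLp.norm_apply_le
    (Matrix.toEuclideanCLM (n := Fin 2) (𝕜 := ℝ) B (EuclideanSpace.single j (1 : ℝ))) i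
  have h3 : (Matrix.toEuclideanCLM (n := Fin 2) (𝕜 := ℝ) B (EuclideanSpace.single j (1 : ℝ))) i
      = B i j := by
    simp [Matrix.ofLp_toEuclideanCLM]
  rw [h3] at h2
  simp at h
  exact h2.trans h

lemma trace_le_two_mul_euclideanNorm (B : Matrix (Fin 2) (Fin 2) ℝ) :
    B.trace ≤ 2 * euclideanNorm B := by
  rw [Matrix.trace_fin_two]
  have h0 := (le_abs_self _).trans (abs_entry_le_euclideanNorm B 0 0)
  have h1 := (le_abs_self _).trans (abs_entry_le_euclideanNorm B 1 1)
  linarith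

lemma euclideanNorm_le_of_sq_le {B : Matrix (Fin 2) (Fin 2) ℝ} {c : ℝ} (hc : 0 ≤ c)
    (h : ∀ a b : ℝ, (B 0 0 * a + B 0 1 * b) ^ 2 + (B 1 0 * a + B 1 1 * b) ^ 2 ≤
      c ^ 2 * (a ^ 2 + b ^ 2)) : euclideanNorm B ≤ c := by
  refine ContinuousLinearMap.opNorm_le_bound _ hc fun x => ?_
  refine le_of_sq_le_sq ?_ (by positivity)
  rw [mul_pow, EuclideanSpace.norm_sq_eq, EuclideanSpace.norm_sq_eq]
  simpa [Matrix.ofLp_toEuclideanCLM, Matrix.mulVec, dotProduct, Fin.sum_univ_two] using h (x 0) (x 1)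

lemma euclideanNorm_le_entrySum {B : Matrix (Fin 2) (Fin 2) ℝ} (hB : DominatesOne B) :
    euclideanNorm B ≤ entrySum B := by
  obtain ⟨b1, b2, b3, b4⟩ := hB
  refine euclideanNorm_le_of_sq_le (by unfold entrySum; linarith) fun a b => ?_
  have hB0 : 0 ≤ B 0 0 := by linarith
  have hB1 : 0 ≤ B 1 1 := by linarith
  have key : ∀ s t : ℝ, 0 ≤ s → 0 ≤ t → (s * a + t * b) ^ 2 ≤ (s + t) ^ 2 * (a ^ 2 + b ^ 2) := by
    intro s t hs ht
    nlinarith [sq_nonneg (s * b - t * a), mul_nonneg (mul_nonneg hs ht) (sq_nonneg a),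
      mul_nonneg (mul_nonneg hs ht) (sq_nonneg b)]
  have k1 := key _ _ hB0 b2
  have k2 := key _ _ b3 hB1
  have : (B 0 0 + B 0 1) ^ 2 + (B 1 0 + B 1 1) ^ 2 ≤ entrySum B ^ 2 := by
    unfold entrySum; nlinarith [mul_nonneg (add_nonneg hB0 b2) (add_nonneg b3 hB1)]
  nlinarith [mul_le_mul_of_nonneg_right this (by positivity : 0 ≤ a ^ 2 + b ^ 2)]

lemma euclideanNorm_mul_le (B C : Matrix (Fin 2) (Fin 2) ℝ) :
    euclideanNorm (B * C) ≤ euclideanNorm B * euclideanNorm C := by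
  unfold euclideanNorm
  rw [map_mul]
  exact norm_mul_le _ _

lemma euclideanNorm_matrixPair_le (a : Fin 2) :
    euclideanNorm (matrixPair 1 a) ≤ (1 + √5) / 2 := by
  have h5 : √5 ^ 2 = 5 := Real.sq_sqrt (by norm_num)
  have h5' : 0 ≤ √5 := Real.sqrt_nonneg 5
  have h2 : 2 ≤ √5 := Real.le_sqrt_of_sq_le (by norm_num)
  have key : ∀ a b : ℝ, (a + b) ^ 2 + b ^ 2 ≤ ((1 + √5) / 2) ^ 2 * (a ^ 2 + b ^ 2) := by
    intro a b
    have e : ((1 + √5) / 2) ^ 2 = (3 + √5) / 2 := by nlinarith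
    -- The golden ratio is the larger singular value of each generator, so the deficit is a perfect
    -- square up to a positive factor.
    have : ((3 + √5) / 2) * (a ^ 2 + b ^ 2) - ((a + b) ^ 2 + b ^ 2) =
        (1 + √5) / 2 * (a - (√5 - 1) / 2 * b) ^ 2 := by
      linear_combination ((-(1/8) * √5 + 1/8) * b ^ 2 + 1 / 2 * a * b) * h5
    rw [e]
    have h' : 0 ≤ (1 + √5) / 2 * (a - (√5 - 1) / 2 * b) ^ 2 := by positivity
    linarith
  refine euclideanNorm_le_of_sq_le (by positivity) fun x y => ?_
  fin_cases a
  · have := key x y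
    simpa [matrixPair_one_zero] using this
  · have : x ^ 2 + (x + y) ^ 2 ≤ ((1 + √5) / 2) ^ 2 * (x ^ 2 + y ^ 2) := by linarith [key y x]
    simpa [matrixPair_one_one] using this

lemma euclideanNorm_prod_le (l : List (Fin 2)) :
    euclideanNorm (l.map (matrixPair 1)).prod ≤ ((1 + √5) / 2) ^ l.length := by
  induction l with
  | nil =>
    refine euclideanNorm_le_of_sq_le (by simp) fun a b => ?_
    simp
  | cons a l ih =>
    simp only [List.map_cons, List.prod_cons, List.length_cons]
    rw [pow_succ']
    refine (euclideanNorm_mul_le _ _).trans ?_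
    refine mul_le_mul (euclideanNorm_matrixPair_le a) ih (norm_nonneg _) (by positivity)

/-! ### Counting ones in infinite words -/

/-- The number of ones among the first `n` letters of `x`. -/
def cnt (x : InfiniteWord) (n : ℕ) : ℕ := ∑ j ∈ Finset.range n, (x j).val

/-- The infinite word obtained by deleting the first `k` letters. -/
def shift (k : ℕ) (x : InfiniteWord) : InfiniteWord := fun i => x (k + i)

lemma cnt_zero (x : InfiniteWord) : cnt x 0 = 0 := rfl

lemma cnt_succ (x : InfiniteWord) (n : ℕ) : cnt x (n + 1) = cnt x n + (x n).val := by
  simp [cnt, Finset.sum_range_succ]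

lemma cnt_add (x : InfiniteWord) (k n : ℕ) : cnt x (k + n) = cnt x k + cnt (shift k x) n := by
  simp [cnt, Finset.sum_range_add, shift]

lemma letter_eq_of_cnt {x y : InfiniteWord} {i j : ℕ}
    (h : (cnt x (i + 1) : ℤ) - cnt x i = cnt y (j + 1) - cnt y j) : x i = y j := by
  rw [cnt_succ, cnt_succ] at h
  apply Fin.ext
  omega

lemma initialWord_length (n : ℕ) (x : InfiniteWord) : (initialWord n x).length = n := by
  simp [initialWord]

lemma initialWord_succ (n : ℕ) (x : InfiniteWord) :
    initialWord (n + 1) x = initialWord n x ++ [x n] := by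
  simp only [initialWord]
  rw [List.ofFn_succ_last]
  simp

lemma initialWord_add (k n : ℕ) (x : InfiniteWord) :
    initialWord (k + n) x = initialWord k x ++ initialWord n (shift k x) := by
  simp [initialWord, List.ofFn_add, shift]

lemma initialWord_congr {n : ℕ} {x y : InfiniteWord} (h : ∀ i < n, x i = y i) :
    initialWord n x = initialWord n y := by
  simp only [initialWord]
  congr 1
  ext i : 1
  exact h i i.2

lemma initialWord_one (x : InfiniteWord) : initialWord 1 x = [x 0] := by
  simp [initialWord]

lemma ones_append (u v : FiniteWord) : ones (u ++ v) = ones u + ones v := by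
  simp [ones]

lemma ones_singleton (a : Fin 2) : ones [a] = a.val := by
  fin_cases a <;> simp [ones]

lemma ones_cons (a : Fin 2) (u : FiniteWord) : ones (a :: u) = a.val + ones u := by
  rw [← List.singleton_append, ones_append, ones_singleton]

lemma ones_flatten_replicate (u : FiniteWord) (n : ℕ) :
    ones (List.replicate n u).flatten = n * ones u := by
  induction n with
  | zero => simp [ones]
  | succ n ih => rw [List.replicate_succ, List.flatten_cons, ones_append, ih]; ring

lemma ones_le_length (u : FiniteWord) : ones u ≤ u.length := List.count_le_length

lemma ones_initialWord (n : ℕ) (x : InfiniteWord) : ones (initialWord n x) = cnt x n := by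
  induction n with
  | zero => simp [initialWord, ones, cnt]
  | succ n ih => rw [initialWord_succ, ones_append, ih, cnt_succ, ones_singleton]

lemma occursAt_iff (u : FiniteWord) (x : InfiniteWord) (k : ℕ) :
    OccursAt u x k ↔ u = initialWord u.length (shift k x) := by
  constructor
  · intro h
    refine List.ext_get (by simp [initialWord]) fun n h1 h2 => ?_
    rw [h ⟨n, h1⟩]
    simp [initialWord, shift]
  · intro h i
    have : u[i.val]'i.2 = (initialWord u.length (shift k x))[i.val]'(by simp [initialWord]) :=
      List.getElem_of_eq h i.2
    simpa [initialWord, shift] using this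

lemma isSubword_initialWord_shift (x : InfiniteWord) (k : ℕ) {n : ℕ} (hn : 0 < n) :
    IsSubword (initialWord n (shift k x)) x := by
  refine ⟨List.ne_nil_of_length_pos (by rwa [initialWord_length]), k, ?_⟩
  rw [occursAt_iff, initialWord_length]

/-- The number of ones in the window of length `n` starting after `i` letters. -/
def win (x : InfiniteWord) (i n : ℕ) : ℤ := (cnt x (i + n) : ℤ) - cnt x i

lemma win_eq (x : InfiniteWord) (i n : ℕ) : win x i n = cnt (shift i x) n := by
  rw [win, cnt_add]; push_cast; ring

lemma isBalanced_iff (x : InfiniteWord) :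
    IsBalanced x ↔ ∀ n i j, win x i n - win x j n ≤ 1 := by
  constructor
  · intro h n i j
    rcases Nat.eq_zero_or_pos n with rfl | hn
    · simp [win]
    have := h _ _ (isSubword_initialWord_shift x i hn) (isSubword_initialWord_shift x j hn)
      (by simp [initialWord_length])
    rw [ones_initialWord, ones_initialWord, ← win_eq, ← win_eq] at this
    exact (abs_le.1 this).2
  · rintro h u v ⟨_, i, hi⟩ ⟨_, j, hj⟩ huv
    rw [occursAt_iff] at hi hj
    rw [hi, hj, ones_initialWord, ones_initialWord, ← win_eq, ← win_eq, ← huv]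
    have h1 := h u.length i j
    have h2 := h u.length j i
    rw [abs_le]; constructor <;> linarith

lemma win_shift (x : InfiniteWord) (k i n : ℕ) : win (shift k x) i n = win x (k + i) n := by
  have h1 := cnt_add x k (i + n)
  have h2 := cnt_add x k i
  simp only [win]
  rw [add_assoc, h1, h2]; push_cast; ring

lemma IsBalanced.shift {x : InfiniteWord} (h : IsBalanced x) (k : ℕ) :
    IsBalanced (shift k x) := by
  rw [isBalanced_iff] at h ⊢
  intro n i j
  rw [win_shift, win_shift]
  exact h _ _ _

/-- Cut the prefix into N windows of length n; by balance each differs from the window at i by at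
most 1. -/
lemma IsBalanced.abs_cnt_mul_sub_le {x : InfiniteWord} (h : IsBalanced x) (i n N : ℕ) :
    |(cnt x (n * N) : ℤ) - N * win x i n| ≤ N := by
  rw [isBalanced_iff] at h
  induction N with
  | zero => simp [cnt]
  | succ N ih =>
    have h1 := h n (n * N) i
    have h2 := h n i (n * N)
    have h3 : (cnt x (n * (N + 1)) : ℤ) = cnt x (n * N) + win x (n * N) n := by
      simp [win, mul_add]
    rw [abs_le] at ih ⊢
    push_cast
    rw [h3]
    constructor <;> linarith

/-- The ones of `x` are distributed with density `γ` up to a discrepancy of one in each window. -/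
def HasSlope (γ : ℝ) (x : InfiniteWord) : Prop :=
  ∀ i n : ℕ, |(win x i n : ℝ) - n * γ| ≤ 1

lemma hasSlope_of_mem_X {γ : ℝ} {x : InfiniteWord} (hx : x ∈ X γ) : HasSlope γ x := by
  obtain ⟨-, hb, ht⟩ := hx
  intro i n
  rcases Nat.eq_zero_or_pos n with rfl | hn
  · simp [win]
  have hn' : (0 : ℝ) < n := by exact_mod_cast hn
  have ht2 : Tendsto (fun N : ℕ => oneRatio (initialWord (n * N) x)) atTop (nhds γ) :=
    ht.comp (tendsto_id.const_mul_atTop' hn)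
  have ht3 : Tendsto (fun N : ℕ => |(win x i n : ℝ) - n * oneRatio (initialWord (n * N) x)|) atTop
      (nhds |(win x i n : ℝ) - n * γ|) :=
    ((ht2.const_mul (n : ℝ)).const_sub _).abs
  refine le_of_tendsto ht3 ?_
  filter_upwards [eventually_gt_atTop 0] with N hN
  have hN' : (0 : ℝ) < N := by exact_mod_cast hN
  have h1 : |(cnt x (n * N) : ℝ) - N * win x i n| ≤ N := by
    exact_mod_cast hb.abs_cnt_mul_sub_le i n N
  rw [oneRatio, ones_initialWord, initialWord_length]
  have h2 : (win x i n : ℝ) - n * ((cnt x (n * N) : ℝ) / ((n * N : ℕ) : ℝ)) =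
      -((cnt x (n * N) : ℝ) - N * win x i n) / N := by
    push_cast; field_simp; ring
  rw [h2, abs_div, abs_neg, abs_of_pos hN', div_le_one hN']
  exact h1

lemma HasSlope.shift {γ : ℝ} {x : InfiniteWord} (h : HasSlope γ x) (k : ℕ) :
    HasSlope γ (shift k x) := fun i n => by
  rw [win_shift]; exact h _ _

lemma HasSlope.abs_cnt_sub_le {γ : ℝ} {x : InfiniteWord} (h : HasSlope γ x) (n : ℕ) :
    |(cnt x n : ℝ) - n * γ| ≤ 1 := by
  simpa [win, cnt] using h 0 n

/-! ### Rational slopes -/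

/-- Both sides add up the letters at positions k + j over k < M and j < q. -/
lemma sum_win (x : InfiniteWord) (q M : ℕ) :
    ∑ k ∈ Finset.range M, win x k q = ∑ j ∈ Finset.range q, win x j M := by
  induction M with
  | zero => simp [win]
  | succ M ih =>
    rw [Finset.sum_range_succ, ih]
    have : ∀ j, win x j (M + 1) = win x j M + ((cnt x (M + j + 1) : ℤ) - cnt x (M + j)) := by
      intro j
      simp only [win]
      rw [show j + (M + 1) = M + j + 1 by ring, show j + M = M + j by ring]; ring
    simp only [this, Finset.sum_add_distrib]
    congr 1
    have h := Finset.sum_range_sub (fun j => (cnt x (M + j) : ℤ)) q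
    simp only [← add_assoc] at h
    rw [h, win]; simp

lemma finite_setOf_one_le {e : ℕ → ℤ} (h0 : ∀ k, 0 ≤ e k) {B : ℕ}
    (hB : ∀ M, ∑ k ∈ Finset.range M, e k ≤ B) : {k | 1 ≤ e k}.Finite := by
  by_contra hinf
  obtain ⟨t, ht, htc⟩ := Set.Infinite.exists_subset_card_eq hinf (B + 1)
  obtain ⟨M, hM⟩ := t.exists_nat_subset_range
  have h1 : ∑ k ∈ t, (1 : ℤ) ≤ ∑ k ∈ t, e k := Finset.sum_le_sum fun k hk => ht hk
  have h2 : ∑ k ∈ t, e k ≤ ∑ k ∈ Finset.range M, e k :=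
    Finset.sum_le_sum_of_subset_of_nonneg hM fun k _ _ => h0 k
  have h3 := hB M
  simp [htc] at h1
  linarith

lemma IsRecurrent.infinite_win_eq {x : InfiniteWord} (h : IsRecurrent x) (i : ℕ) {n : ℕ}
    (hn : 0 < n) : {k | win x k n = win x i n}.Infinite := by
  refine (h _ (isSubword_initialWord_shift x i hn)).mono fun k hk => ?_
  have hk' : OccursAt (initialWord n (BalancedProducts.shift i x)) x k := hk
  rw [occursAt_iff, initialWord_length] at hk'
  have := congrArg ones hk'
  rw [ones_initialWord, ones_initialWord] at this
  simp only [Set.mem_ofPred_eq, win_eq, this]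

/-- Deviations of length-q windows from p lie in {-1, 0, 1}, and balance forbids both signs. By
`sum_win` their partial sums are bounded by q, so only finitely many are nonzero, whereas recurrence
would repeat a nonzero one infinitely often. -/
lemma win_eq_of_mem_X {p q : ℕ} (hq : 0 < q) {x : InfiniteWord}
    (hx : x ∈ X ((p : ℝ) / q)) (i : ℕ) : win x i q = p := by
  have hq' : (q : ℝ) ≠ 0 := by positivity
  have hs := hasSlope_of_mem_X hx
  have h1 : ∀ k, |win x k q - p| ≤ 1 := by
    intro k
    have := hs k q
    rw [mul_div_cancel₀ _ hq'] at this
    exact_mod_cast this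
  have hb := (isBalanced_iff x).1 hx.2.1
  have hsum : ∀ M : ℕ, |∑ k ∈ Finset.range M, (win x k q - (p : ℤ))| ≤ q := by
    intro M
    have e : ((∑ k ∈ Finset.range M, (win x k q - (p : ℤ)) : ℤ) : ℝ) =
        ∑ j ∈ Finset.range q, ((win x j M : ℝ) - M * (p / q)) := by
      rw [Finset.sum_sub_distrib, sum_win]
      push_cast
      rw [Finset.sum_sub_distrib]
      simp
      field_simp
    have : |((∑ k ∈ Finset.range M, (win x k q - (p : ℤ)) : ℤ) : ℝ)| ≤ q := by
      rw [e]
      refine (Finset.abs_sum_le_sum_abs _ _).trans ?_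
      refine (Finset.sum_le_sum fun j _ => hs j M).trans ?_
      simp
    exact_mod_cast this
  by_contra hne
  have hinf := hx.1.infinite_win_eq i hq
  rcases lt_or_gt_of_ne hne with hlt | hgt
  · refine hinf ((finite_setOf_one_le (e := fun k => p - win x k q) (B := q)
      (fun k => ?_) fun M => ?_).subset fun k hk => ?_)
    · have a1 := hb q k i
      have := abs_le.1 (h1 k)
      linarith
    · have := (abs_le.1 (hsum M)).1
      have e : ∑ k ∈ Finset.range M, ((p : ℤ) - win x k q) =
        -∑ k ∈ Finset.range M, (win x k q - (p : ℤ)) := by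
        rw [← Finset.sum_neg_distrib]; simp
      rw [e]; linarith
    · have hk' : win x k q = win x i q := hk
      simp only [Set.mem_ofPred_eq]; omega
  · refine hinf ((finite_setOf_one_le (e := fun k => win x k q - p) (B := q)
      (fun k => ?_) fun M => (abs_le.1 (hsum M)).2).subset fun k hk => ?_)
    · have a1 := hb q i k
      linarith
    · have hk' : win x k q = win x i q := hk
      simp only [Set.mem_ofPred_eq]; omega

lemma letter_add_eq_of_mem_X {p q : ℕ} (hq : 0 < q) {x : InfiniteWord}
    (hx : x ∈ X ((p : ℝ) / q)) (i : ℕ) : x (i + q) = x i := by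
  have h1 := win_eq_of_mem_X hq hx i
  have h2 := win_eq_of_mem_X hq hx (i + 1)
  apply letter_eq_of_cnt
  simp only [win] at h1 h2
  rw [show i + 1 + q = i + q + 1 by ring] at h2
  linarith

/-- A periodic balanced word is recurrent with the expected 1-ratio. -/
lemma mem_X_of_periodic {x : InfiniteWord} {q : ℕ} (hq : 0 < q) (hb : IsBalanced x)
    (hper : ∀ i, x (i + q) = x i) : x ∈ X ((cnt x q : ℝ) / q) := by
  have hq' : (0 : ℝ) < q := by positivity
  have hper' : ∀ N i, x (i + N * q) = x i := by
    intro N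
    induction N with
    | zero => simp
    | succ N ih => intro i; rw [Nat.succ_mul, ← add_assoc, hper, ih]
  have hcnt : ∀ N, cnt x (N * q) = N * cnt x q := by
    intro N
    induction N with
    | zero => simp [cnt]
    | succ N ih =>
      have hs : shift (N * q) x = x := by
        funext i; rw [shift, add_comm, hper']
      rw [Nat.succ_mul, cnt_add, ih, hs]; ring
  refine ⟨?_, hb, ?_⟩
  · rintro u ⟨_, k, hk⟩
    refine Set.infinite_of_injective_forall_mem (f := fun N => k + N * q) (fun a b hab => ?_) ?_
    · simpa [hq.ne'] using hab
    · intro N i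
      rw [hk i, add_right_comm, hper']
  · have key : ∀ n : ℕ, |(cnt x n : ℝ) - n * (cnt x q / q)| ≤ 1 := by
      intro n
      have h1 := hb.abs_cnt_mul_sub_le 0 n q
      have h2 : win x 0 n = cnt x n := by simp [win, cnt]
      rw [hcnt, h2] at h1
      have h3 : |(n * cnt x q : ℝ) - q * cnt x n| ≤ q := by exact_mod_cast h1
      have e : (cnt x n : ℝ) - n * (cnt x q / q) = -((n * cnt x q : ℝ) - q * cnt x n) / q := by
        field_simp; ring
      rw [e, abs_div, abs_neg, abs_of_pos hq', div_le_one hq']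
      exact h3
    rw [tendsto_iff_norm_sub_tendsto_zero]
    refine squeeze_zero' (Eventually.of_forall fun _ => norm_nonneg _) ?_
      tendsto_one_div_atTop_nhds_zero_nat
    filter_upwards [eventually_gt_atTop 0] with n hn
    have hn' : (0 : ℝ) < n := by exact_mod_cast hn
    rw [oneRatio, ones_initialWord, initialWord_length, Real.norm_eq_abs, le_div_iff₀ hn',
      ← abs_of_pos hn', ← abs_mul, abs_of_pos hn']
    have : ((cnt x n : ℝ) / n - cnt x q / q) * n = cnt x n - n * (cnt x q / q) := by
      field_simp
    rw [this]; exact key n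

/-- The mechanical word of slope `p / q`. -/
def mech (p q : ℕ) : InfiniteWord :=
  fun i => if (i + 1) * p / q = i * p / q then 0 else 1

/-! ### Mechanical words as the model of every word of equal or nearby slope -/

section
variable {p q : ℕ}

lemma cnt_mech (hq : 0 < q) (hpq : p ≤ q) (n : ℕ) : cnt (mech p q) n = n * p / q := by
  induction n with
  | zero => simp [cnt]
  | succ n ih =>
    have h1 : n * p / q ≤ (n + 1) * p / q := Nat.div_le_div_right (by nlinarith)
    have h2 : (n + 1) * p / q ≤ n * p / q + 1 := by
      rw [← Nat.add_div_right _ hq]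
      exact Nat.div_le_div_right (by nlinarith)
    rw [cnt_succ, ih, mech]
    split_ifs with h
    · simp [h]
    · simp; omega

lemma mech_add (hq : 0 < q) (i : ℕ) : mech p q (i + q) = mech p q i := by
  have h : ∀ j, (j + q) * p / q = j * p / q + p := by
    intro j; rw [add_mul, Nat.add_mul_div_left _ _ hq]
  rw [mech, mech, show i + q + 1 = i + 1 + q by ring, h, h]
  simp

lemma isBalanced_mech (hq : 0 < q) (hpq : p ≤ q) : IsBalanced (mech p q) := by
  rw [isBalanced_iff]
  intro n i j
  simp only [win, cnt_mech hq hpq]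
  have k1 : ∀ m : ℕ, q * (m / q) ≤ m := fun m => Nat.mul_div_le m q
  have k2 : ∀ m : ℕ, m < q * (m / q) + q := fun m => Nat.lt_mul_div_succ m hq
  have a1 := k1 ((i + n) * p)
  have a2 := k2 (i * p)
  have a3 := k2 ((j + n) * p)
  have a4 := k1 (j * p)
  generalize (i + n) * p / q = A at *
  generalize i * p / q = B at *
  generalize (j + n) * p / q = C at *
  generalize j * p / q = D at *
  by_contra! hc
  zify at a1 a2 a3 a4 hq
  nlinarith

lemma mech_mem_X (hq : 0 < q) (hpq : p ≤ q) : mech p q ∈ X ((p : ℝ) / q) := by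
  have := mem_X_of_periodic hq (isBalanced_mech hq hpq) (mech_add hq)
  rwa [cnt_mech hq hpq, Nat.mul_div_cancel_left _ hq] at this

lemma shift_mem_X_of_periodic (hq : 0 < q) {x : InfiniteWord} (hx : x ∈ X ((p : ℝ) / q)) (k : ℕ) :
    shift k x ∈ X ((p : ℝ) / q) := by
  have h := mem_X_of_periodic hq (hx.2.1.shift k) (fun i => by
    rw [shift, shift, ← add_assoc]; exact letter_add_eq_of_mem_X hq hx _)
  have h2 := win_eq_of_mem_X hq hx k
  rw [win_eq] at h2
  have h3 : cnt (shift k x) q = p := by exact_mod_cast h2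
  rwa [h3] at h

/-- A word whose slope is close to `p / q` locally agrees with a shift of the mechanical word of
slope `p / q`. -/
lemma exists_eq_mech {γ : ℝ} {x : InfiniteWord} (hx : HasSlope γ x) (hq : 0 < q) (hpq : p ≤ q)
    (hcop : Nat.Coprime p q) (hγ : |q * γ - p| * (q - 1) < 1) :
    ∃ k, ∀ i < q - 1, x i = mech p q (k + i) := by
  have hqZ : (0 : ℤ) < q := by exact_mod_cast hq
  set c : ℕ → ℤ := fun i => q * cnt x i - i * p with hc
  have hle : ∀ i n, i + n ≤ q - 1 → |c (i + n) - c i| ≤ q - 1 := by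
    intro i n hin
    rcases Nat.eq_zero_or_pos n with rfl | hn
    · simp; omega
    have e : c (i + n) - c i = q * win x i n - n * p := by
      simp only [hc, win]; push_cast; ring
    have hn1 : (n : ℝ) ≤ q - 1 := by
      have : (n : ℝ) + 1 ≤ q := by exact_mod_cast (by omega : n + 1 ≤ q)
      linarith
    have h1 : |((q * win x i n - n * p : ℤ) : ℝ)| < q + 1 := by
      have h2 := hx i n
      have h3 : ((q * win x i n - n * p : ℤ) : ℝ) =
          q * ((win x i n : ℝ) - n * γ) + n * (q * γ - p) := by push_cast; ring
      rw [h3]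
      have h4 : |(q : ℝ) * ((win x i n : ℝ) - n * γ)| ≤ q := by
        rw [abs_mul, Nat.abs_cast]
        exact mul_le_of_le_one_right (by positivity) h2
      have h5 : |(n : ℝ) * (q * γ - p)| < 1 := by
        rw [abs_mul, Nat.abs_cast, mul_comm]
        exact (mul_le_mul_of_nonneg_left hn1 (abs_nonneg _)).trans_lt hγ
      exact (abs_add_le _ _).trans_lt (by linarith)
    have h1' : |q * win x i n - n * p| < q + 1 := by exact_mod_cast h1
    -- The slope estimate alone allows the value q; coprimality with 0 < n < q excludes it.
    have hndvd : ¬ (q : ℤ) ∣ q * win x i n - n * p := by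
      intro hd
      have h2 : (q : ℤ) ∣ n * p := by
        have := dvd_sub (Dvd.intro (win x i n) rfl) hd
        simpa using this
      have h3 : q ∣ n * p := by exact_mod_cast h2
      have h4 := Nat.le_of_dvd hn (hcop.symm.dvd_of_dvd_mul_right h3)
      omega
    rw [e]
    by_contra! hlt
    have : |q * win x i n - n * p| = q := by omega
    exact hndvd ((dvd_abs _ _).1 ⟨1, by rw [this]; ring⟩)
  -- Normalizing by the maximum of c places every c m - c i in [0, q - 1], so it can serve as a
  -- remainder modulo q.
  obtain ⟨m, hm, hmax⟩ := (Finset.range q).exists_max_image c ⟨0, by simpa using hq⟩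
  have hmq : m < q := by simpa using hm
  have hclose : ∀ i < q, 0 ≤ c m - c i ∧ c m - c i ≤ q - 1 := by
    intro i hi
    refine ⟨by linarith [hmax i (by simpa using hi)], ?_⟩
    rcases le_total i m with h | h
    · obtain ⟨n, rfl⟩ := Nat.exists_eq_add_of_le h
      exact (le_abs_self _).trans (hle i n (by omega))
    · obtain ⟨n, rfl⟩ := Nat.exists_eq_add_of_le h
      have := hle m n (by omega)
      rw [abs_sub_comm] at this
      exact (le_abs_self _).trans this
  have hc0 : 0 ≤ c m := by simpa [hc, cnt] using (hclose 0 hq).1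
  -- Invert p modulo q to start the mechanical word at the phase congruent to c m; its floors then
  -- differ from the counts of x by the constant t.
  obtain ⟨k, t, hkt⟩ : ∃ k : ℕ, ∃ t : ℤ, (k * p : ℤ) = c m + q * t := by
    obtain ⟨a, b, hab⟩ := (Nat.isCoprime_iff_coprime.2 hcop)
    refine ⟨((c m * a) % q).toNat, -(c m * b) - p * ((c m * a) / q), ?_⟩
    rw [Int.toNat_of_nonneg (Int.emod_nonneg _ hqZ.ne')]
    have := Int.emod_add_mul_ediv (c m * a) q
    linear_combination p * this + c m * hab
  have hfloor : ∀ i < q, (cnt (mech p q) (k + i) : ℤ) = cnt x i + t := by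
    intro i hi
    rw [cnt_mech hq hpq]
    push_cast
    obtain ⟨h1, h2⟩ := hclose i hi
    have e : ((k + i) * p : ℤ) = (c m - c i) + q * (cnt x i + t) := by
      rw [add_mul, hkt]; simp only [hc]; ring
    rw [e, Int.add_mul_ediv_left _ _ hqZ.ne', Int.ediv_eq_zero_of_lt h1 (by linarith), zero_add]
  refine ⟨k, fun i hi => letter_eq_of_cnt ?_⟩
  have h1 := hfloor i (by omega)
  have h2 := hfloor (i + 1) (by omega)
  rw [← add_assoc] at h2
  linarith

/-- Recurrent balanced words of rational slope are shifts of mechanical words. -/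
lemma eq_shift_mech (hq : 0 < q) (hpq : p ≤ q) (hcop : Nat.Coprime p q) {x : InfiniteWord}
    (hx : x ∈ X ((p : ℝ) / q)) : ∃ k, x = shift k (mech p q) := by
  have hq' : (q : ℝ) ≠ 0 := by positivity
  obtain ⟨k, hk⟩ := exists_eq_mech (hasSlope_of_mem_X hx) hq hpq hcop (by
    rw [mul_div_cancel₀ _ hq']; simp)
  refine ⟨k, ?_⟩
  have hy := shift_mem_X_of_periodic hq (mech_mem_X hq hpq) k
  set y := shift k (mech p q) with hydef
  have hagree : ∀ i ≤ q - 1, cnt x i = cnt y i := by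
    intro i hi
    rw [cnt, cnt]
    refine Finset.sum_congr rfl fun j hj => ?_
    rw [hk j (by have := Finset.mem_range.1 hj; omega), hydef, shift]
  have hlt : ∀ i < q, x i = y i := by
    intro i hi
    apply letter_eq_of_cnt
    rw [hagree i (by omega)]
    rcases Nat.lt_or_ge (i + 1) q with h | h
    · rw [hagree (i + 1) (by omega)]
    · have hi1 : i + 1 = q := by omega
      -- Agreement is known only for q - 1 letters; the last letter is forced because both periods
      -- contain p ones.
      have h1 := win_eq_of_mem_X hq hx 0
      have h2 := win_eq_of_mem_X hq hy 0
      simp only [win, zero_add, cnt_zero] at h1 h2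
      rw [hi1]; linarith
  have hmod : ∀ {z : InfiniteWord}, z ∈ X ((p : ℝ) / q) → ∀ i, z i = z (i % q) := fun hz i =>
    (Function.Periodic.map_mod_nat (letter_add_eq_of_mem_X hq hz) i).symm
  funext i
  rw [hmod hx, hmod hy, hlt _ (Nat.mod_lt _ hq)]

end

/-! ### Maximal traces -/

/-- Reflection in the antidiagonal is an anti-automorphism fixing both generators. -/
lemma wordProduct_reverse (u : FiniteWord) :
    wordProduct u.reverse = !![wordProduct u 1 1, wordProduct u 0 1;
      wordProduct u 1 0, wordProduct u 0 0] := by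
  induction u with
  | nil => ext i j; fin_cases i <;> fin_cases j <;> simp [wordProduct_nil]
  | cons a u ih =>
    rw [List.reverse_cons, wordProduct_append, ih, wordProduct_singleton, wordProduct_cons]
    fin_cases a <;> ext i j <;> fin_cases i <;> fin_cases j <;>
      simp [matrixPair_one_zero, matrixPair_one_one, Matrix.mul_apply, Fin.sum_univ_two] <;> ring

/-- Replacing an unbalanced configuration by a balanced one increases the trace. -/
lemma trace_lt_trace_exchange {p : FiniteWord} (hp : p.reverse = p) (b w : FiniteWord) :
    (wordProduct (0 :: (p ++ 0 :: (b ++ 1 :: (p ++ 1 :: w))))).trace <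
      (wordProduct (0 :: (p ++ 1 :: (b.reverse ++ 0 :: (p ++ 1 :: w))))).trace := by
  -- A palindrome has equal diagonal entries.
  have hP := wordProduct_reverse p
  rw [hp] at hP
  have hP1 : wordProduct p 1 1 = wordProduct p 0 0 := by
    have := congrFun (congrFun hP 1) 1; simpa using this
  have hPd := det_wordProduct p
  obtain ⟨b1, b2, b3, b4⟩ := dominatesOne_wordProduct b
  obtain ⟨w1, w2, w3, w4⟩ := dominatesOne_wordProduct w
  simp only [wordProduct_cons, wordProduct_append, wordProduct_reverse b]
  rw [Matrix.det_fin_two, hP1] at hPd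
  generalize wordProduct p = P at *
  generalize wordProduct b = U at *
  generalize wordProduct w = V at *
  rw [← sub_pos]
  rw [Matrix.eta_fin_two P, Matrix.eta_fin_two U, Matrix.eta_fin_two V, hP1]
  simp only [matrixPair_one_zero, matrixPair_one_one, Matrix.trace_fin_two, Matrix.mul_apply,
    Fin.sum_univ_two, Matrix.of_apply, Matrix.cons_val', Matrix.cons_val_zero, Matrix.cons_val_one,
    Matrix.cons_val_fin_one]
  generalize P 0 0 = a at *
  generalize P 0 1 = c at *
  generalize P 1 0 = d at *
  generalize U 0 0 = u1 at *
  generalize U 0 1 = u2 at *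
  generalize U 1 0 = u3 at *
  generalize U 1 1 = u4 at *
  generalize V 0 0 = v1 at *
  generalize V 0 1 = v2 at *
  generalize V 1 0 = v3 at *
  generalize V 1 1 = v4 at *
  -- The difference of the two traces is this product times det P = 1.
  have hpos : 0 < (u2 + u3 + u4) * (v1 + v2 + v3) := by
    apply mul_pos <;> linarith
  refine hpos.trans_eq ?_
  linear_combination -((u2 + u3 + u4) * (v1 + v2 + v3)) * hPd

lemma trace_wordProduct_initialWord_shift_one {y : InfiniteWord} {n : ℕ} (hn : 0 < n)
    (hy : ∀ i, y (i + n) = y i) :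
    (wordProduct (initialWord n (shift 1 y))).trace = (wordProduct (initialWord n y)).trace := by
  obtain ⟨m, rfl⟩ := Nat.exists_eq_succ_of_ne_zero hn.ne'
  have h1 : initialWord (m + 1) y = [y 0] ++ initialWord m (shift 1 y) := by
    rw [add_comm, initialWord_add, initialWord_one]
  have h2 : shift 1 y m = y 0 := by
    rw [shift, add_comm]; simpa using hy 0
  rw [Nat.succ_eq_add_one, initialWord_succ, h1, wordProduct_append, wordProduct_append,
    Matrix.trace_mul_comm, h2]

lemma shift_shift (i j : ℕ) (y : InfiniteWord) : shift i (shift j y) = shift (j + i) y := by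
  funext k; simp [shift, add_assoc]

lemma trace_wordProduct_initialWord_shift {y : InfiniteWord} {n : ℕ} (hn : 0 < n)
    (hy : ∀ i, y (i + n) = y i) (k : ℕ) :
    (wordProduct (initialWord n (shift k y))).trace = (wordProduct (initialWord n y)).trace := by
  induction k with
  | zero => congr 3; funext i; simp [shift]
  | succ k ih =>
    rw [← ih, ← shift_shift]
    refine trace_wordProduct_initialWord_shift_one hn fun i => ?_
    rw [shift, shift, ← add_assoc, hy]

/-- The combinatorial structure of a shortest imbalance in a periodic word: two disjoint
factors `0p0` and `1p1` with `p` a palindrome. -/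
lemma exists_exchange {y : InfiniteWord} {n m j : ℕ} (hn : 0 < n)
    (hy : ∀ i, y (i + n) = y i) (hmin : ∀ k < m, ∀ i j, win y i k - win y j k ≤ 1)
    (hm : 2 ≤ win y j m - win y 0 m) :
    ∃ p b w : FiniteWord, p.reverse = p ∧
      ∃ k, initialWord n (shift k y) = 0 :: (p ++ 0 :: (b ++ 1 :: (p ++ 1 :: w))) := by
  have hwper : ∀ k i, win y (i + n) k = win y i k := by
    intro k i
    have e : shift (i + n) y = shift i y := by
      funext t; rw [shift, shift, add_right_comm, hy]
    rw [win_eq, win_eq, e]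
  wlog hjn : j < n generalizing j
  · refine this (j := j % n) ?_ (Nat.mod_lt _ hn)
    rwa [Function.Periodic.map_mod_nat (f := fun i => win y i m) (hwper m)]
  have hwadd : ∀ i k l, win y i (k + l) = win y i k + win y (i + k) l := by
    intro i k l; simp only [win, ← add_assoc]; ring
  -- If the windows overlapped, the common part would cancel and leave a shorter imbalance. The next
  -- bound excludes the same overlap across the end of the period.
  have hdisj1 : m ≤ j := by
    by_contra! hlt
    rcases Nat.eq_zero_or_pos j with rfl | hj
    · simp at hm
    · have h1 := hwadd 0 j m
      have h2 := hwadd 0 m j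
      rw [add_comm m j] at h2
      have h3 := hmin j hlt m 0
      simp only [zero_add] at h1 h2
      linarith
  have hdisj2 : j + m ≤ n := by
    by_contra! hlt
    obtain ⟨s, hs⟩ := Nat.exists_eq_add_of_lt hjn
    have hsm : s + 1 < m := by omega
    have h1 := hwadd j (s + 1) m
    have h2 := hwadd j m (s + 1)
    rw [add_comm m (s + 1)] at h2
    have h3 := hmin (s + 1) hsm j (j + m)
    have h4 := hwper m 0
    rw [zero_add, show n = j + (s + 1) by omega] at h4
    linarith
  -- The total excess is at least 2, while minimality allows at most 1 in a proper prefix and at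
  -- most 1 in the complementary suffix.
  have hE : ∀ k, 0 < k → k < m → win y j k - win y 0 k = 1 := by
    intro k hk hkm
    obtain ⟨l, rfl⟩ := Nat.exists_eq_add_of_lt hkm
    have h1 := hmin k hkm j 0
    have h2 := hmin (l + 1) (by omega) (j + k) (0 + k)
    rw [add_assoc, hwadd, hwadd 0] at hm
    linarith
  have hm2 : 2 ≤ m := by
    by_contra! hlt
    have hw0 : ∀ i, win y i 0 = 0 := fun i => by simp [win]
    have hw1 : ∀ i, win y i 1 = (y i).val := fun i => by simp [win, cnt_succ]
    interval_cases m
    · rw [hw0, hw0] at hm; omega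
    · rw [hw1, hw1] at hm; omega
  obtain ⟨l, rfl⟩ := Nat.exists_eq_add_of_le hm2
  have hw1 : ∀ i, win y i 1 = (y i).val := fun i => by simp [win, cnt_succ]
  have hEm : win y j (2 + l) - win y 0 (2 + l) = 2 := by
    have h1 := hE 1 one_pos (by omega)
    have h2 := hmin (1 + l) (by omega) (j + 1) (0 + 1)
    rw [show 2 + l = 1 + (1 + l) by ring, hwadd, hwadd 0] at hm ⊢
    linarith
  have hl0 : y 0 = 0 ∧ y j = 1 := by
    have h1 := hE 1 one_pos (by omega)
    rw [hw1, hw1] at h1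
    constructor <;> apply Fin.ext <;> simp <;> omega
  have hl1 : y (1 + l) = 0 ∧ y (j + (1 + l)) = 1 := by
    have h1 := hE (1 + l) (by omega) (by omega)
    rw [show 2 + l = (1 + l) + 1 by ring, hwadd, hwadd 0, hw1, hw1] at hEm
    rw [zero_add] at hEm
    constructor <;> apply Fin.ext <;> simp <;> omega
  have hsame : ∀ t < l, y (j + 1 + t) = y (1 + t) := by
    intro t ht
    have h1 := hE (1 + t) (by omega) (by omega)
    have h2 := hE (1 + t + 1) (by omega) (by omega)
    rw [hwadd, hwadd 0, hw1, hw1] at h2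
    rw [← add_assoc, zero_add] at h2
    apply Fin.ext; omega
  -- The windows now read 0p0 and 1p1. Minimality is applied to 1·(prefix of p) against (suffix of
  -- p)·0, and to (suffix of p)·1 against 0·(prefix of p), giving the two inequalities.
  have hpal0 : ∀ t ≤ l, win y 1 t = win y (1 + l - t) t := by
    intro t ht
    have a1 := hmin (1 + t) (by omega) j (1 + l - t)
    have a2 := hmin (1 + t) (by omega) (j + (1 + l - t)) 0
    have e1 := hwadd j 1 t
    have e2 := hwadd (1 + l - t) t 1
    have e3 := hwadd (j + (1 + l - t)) t 1
    have e4 := hwadd 0 1 t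
    have e5 := hwadd j (1 + l - t) t
    have e6 := hwadd 0 (1 + l - t) t
    have e7 := hE (1 + l - t) (by omega) (by omega)
    have e8 := hE (1 + l) (by omega) (by omega)
    have e9 := hE (1 + t) (by omega) (by omega)
    rw [add_comm t 1, hw1, show 1 + l - t + t = 1 + l by omega, hl1.1] at e2
    rw [add_comm t 1, hw1, show j + (1 + l - t) + t = j + (1 + l) by omega, hl1.2] at e3
    rw [hw1, hl0.2] at e1
    rw [hw1, hl0.1] at e4
    rw [show 1 + l - t + t = 1 + l by omega] at e5 e6
    rw [zero_add] at e4 e6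
    simp only [Fin.val_zero, Fin.val_one, Nat.cast_zero, Nat.cast_one] at e1 e2 e3 e4
    linarith
  have hpal : ∀ t < l, y (1 + t) = y (l - t) := by
    intro t ht
    have h1 := hpal0 t ht.le
    have h2 := hpal0 (t + 1) ht
    rw [hwadd, hw1, show 1 + l - (t + 1) = l - t by omega, add_comm t 1, hwadd (l - t), hw1,
      show l - t + 1 = 1 + l - t by omega] at h2
    apply Fin.ext; omega
  obtain ⟨B, rfl⟩ := Nat.exists_eq_add_of_le hdisj1
  obtain ⟨W, rfl⟩ := Nat.exists_eq_add_of_le hdisj2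
  refine ⟨initialWord l (shift 1 y), initialWord B (shift (2 + l) y),
    initialWord W (shift (2 + l + B + (2 + l)) y), ?_, 0, ?_⟩
  · refine List.ext_getElem (by simp) fun t h1 h2 => ?_
    rw [initialWord_length] at h2
    simp only [initialWord, List.getElem_reverse, List.getElem_ofFn, List.length_ofFn, shift]
    rw [hpal t h2]
    congr 1; omega
  · have hs0 : shift 0 y = y := by funext i; simp [shift]
    have hfac : ∀ i, initialWord (2 + l) (shift i y) =
        y i :: (initialWord l (shift (i + 1) y) ++ [y (i + (1 + l))]) := by
      intro i
      rw [show 2 + l = 1 + (l + 1) by ring, initialWord_add, initialWord_one, initialWord_succ,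
        shift_shift]
      simp only [shift, List.singleton_append, add_zero, add_assoc]
    have hp : initialWord l (shift (2 + l + B + 1) y) = initialWord l (shift 1 y) :=
      initialWord_congr fun t ht => hsame t ht
    have h1 := hfac 0
    have h2 := hfac (2 + l + B)
    rw [hs0, zero_add, zero_add, hl0.1, hl1.1] at h1
    rw [hl0.2, hl1.2, hp] at h2
    rw [hs0, initialWord_add, initialWord_add, initialWord_add, h1, h2]
    simp

/-- A shortest imbalance would permit the exchange, which keeps length and number of ones but
increases the trace, against maximality. -/
lemma isBalanced_of_trace_max {y : InfiniteWord} {n : ℕ} (hn : 0 < n)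
    (hy : ∀ i, y (i + n) = y i)
    (hmax : ∀ u : FiniteWord, u.length = n → ones u = cnt y n →
      (wordProduct u).trace ≤ (wordProduct (initialWord n y)).trace) : IsBalanced y := by
  rw [isBalanced_iff]
  by_contra! hne
  classical
  have hmin := fun k (hk : k < Nat.find hne) => Nat.find_min hne hk
  obtain ⟨j, i, hij⟩ := Nat.find_spec hne
  set m := Nat.find hne with hm
  -- Adding periods moves the heavy window to the right of the light one, so that `exists_exchange`
  -- applies to the word shifted by i.
  have hpos : ∀ i', ∃ i₁, i ≤ i₁ ∧ ∀ k, win y i₁ k = win y i' k := by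
    intro i'
    refine ⟨i' + i * n, by nlinarith, fun k => ?_⟩
    have e : shift (i' + i * n) y = shift i' y := by
      funext t
      rw [shift, shift, add_right_comm]
      exact Function.Periodic.nat_mul (f := y) hy i _
    rw [win_eq, win_eq, e]
  obtain ⟨j₁, hj₁, hj₁w⟩ := hpos j
  obtain ⟨j₂, rfl⟩ := Nat.exists_eq_add_of_le hj₁
  have hy' : ∀ t, shift i y (t + n) = shift i y t := by
    intro t; rw [shift, shift, ← add_assoc, hy]
  obtain ⟨p, b, w, hp, k, hk⟩ := exists_exchange (y := shift i y) (m := m) (j := j₂) hn hy'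
    (fun k hk a c => by
      have := hmin k hk
      push Not at this
      rw [win_shift, win_shift]
      exact this _ _)
    (by rw [win_shift, win_shift, hj₁w, add_zero]; linarith)
  have htr := trace_wordProduct_initialWord_shift hn hy (i + k)
  rw [← shift_shift, hk] at htr
  have hlen := congrArg List.length hk
  have hone := congrArg ones hk
  rw [initialWord_length] at hlen
  rw [shift_shift, ones_initialWord] at hone
  have hcnt : cnt (shift (i + k) y) n = cnt y n := by
    have h1 := cnt_add y (i + k) n
    have h2 := cnt_add y n (i + k)
    have h3 : shift n y = y := by funext t; rw [shift, add_comm, hy]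
    rw [h3, add_comm n] at h2
    omega
  have hlt := trace_lt_trace_exchange hp b w
  rw [htr] at hlt
  refine absurd (hmax _ ?_ ?_) (not_le.2 hlt)
  · rw [hlen]; simp
  · rw [← hcnt, hone]
    have hrev : ones b.reverse = ones b := by simp [ones]
    simp only [ones_cons, ones_append, hrev]; ring

/-- Recurrent balanced words maximize the trace among all words with the same number of ones. -/
theorem trace_le_trace_cocycle {w : FiniteWord} {x : InfiniteWord} {n k : ℕ} (hn : 0 < n)
    (hwn : w.length = n) (hwk : ones w = k) (hx : x ∈ X ((k : ℝ) / n)) :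
    (wordProduct w).trace ≤ (cocycle x n).trace := by
  have hfin : {u : FiniteWord | u.length = n ∧ ones u = k}.Finite :=
    (List.finite_length_eq (Fin 2) n).subset fun u hu => hu.1
  obtain ⟨v, ⟨hvn, hvk⟩, hvmax⟩ := Set.exists_max_image _ (fun u => (wordProduct u).trace) hfin
    ⟨w, hwn, hwk⟩
  set y : InfiniteWord := fun i => v[i % n]'(by rw [hvn]; exact Nat.mod_lt _ hn) with hydef
  have hyv : initialWord n y = v := by
    refine List.ext_getElem (by rw [initialWord_length, hvn]) fun i h1 h2 => ?_
    have : i % n = i := Nat.mod_eq_of_lt (by omega)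
    simp [initialWord, hydef, this]
  have hy : ∀ i, y (i + n) = y i := by intro i; simp [hydef]
  have hyk : cnt y n = k := by rw [← ones_initialWord, hyv, hvk]
  have hbal : IsBalanced y := isBalanced_of_trace_max hn hy fun u hu hu' => by
    rw [hyv]; exact hvmax u ⟨hu, hu'.trans hyk⟩
  have hyX := mem_X_of_periodic hn hbal hy
  rw [hyk] at hyX
  have hkn : k ≤ n := by rw [← hwk, ← hwn]; exact ones_le_length w
  obtain ⟨g, hg, hcop⟩ : ∃ g, 0 < g ∧ ∃ p q, Nat.Coprime p q ∧ k = p * g ∧ n = q * g :=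
    ⟨Nat.gcd k n, Nat.gcd_pos_of_pos_right _ hn, Nat.exists_coprime k n⟩
  obtain ⟨p, q, hpq, rfl, hnq⟩ := hcop
  have hq : 0 < q := Nat.pos_of_ne_zero (by rintro rfl; omega)
  have hple : p ≤ q := by rw [hnq] at hkn; exact Nat.le_of_mul_le_mul_right hkn hg
  have e : ((p * g : ℕ) : ℝ) / n = p / q := by
    rw [hnq]; push_cast
    have : (g : ℝ) ≠ 0 := by positivity
    field_simp
  rw [e] at hx hyX
  obtain ⟨a, rfl⟩ := eq_shift_mech hq hple hpq hx
  obtain ⟨c, hc⟩ := eq_shift_mech hq hple hpq hyX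
  have hmper : ∀ i, mech p q (i + n) = mech p q i := by
    intro i
    rw [hnq, mul_comm]
    exact Function.Periodic.nat_mul (f := mech p q) (mech_add hq) g i
  -- The given word and the periodic maximizer are shifts of one mechanical word, and rotating a
  -- period preserves the trace.
  rw [cocycle, trace_wordProduct_initialWord_shift hn hmper,
    ← trace_wordProduct_initialWord_shift hn hmper c, ← hc, hyv]
  exact hvmax w ⟨hwn, hwk⟩

/-! ### The growth function -/

/-- The affine function `a t + b` dominates the exponential growth rate of the traces of the
products along words with 1-ratio `t`. -/
def IsMajorant (a b : ℝ) : Prop :=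
  ∃ C : ℝ, ∀ u : FiniteWord, Real.log (wordProduct u).trace ≤ a * ones u + b * u.length + C

/-- The growth rate function, defined as the infimum of its affine majorants. -/
noncomputable def growth (γ : ℝ) : ℝ :=
  ⨅ c : {c : ℝ × ℝ // IsMajorant c.1 c.2}, c.1.1 * γ + c.1.2

lemma nonpos_of_forall_nat_mul_le {t C : ℝ} (h : ∀ n : ℕ, n * t ≤ C) : t ≤ 0 := by
  by_contra! ht
  obtain ⟨n, hn⟩ := exists_nat_gt (C / t)
  rw [div_lt_iff₀ ht] at hn
  linarith [h n]

lemma trace_wordProduct_pos (u : FiniteWord) : 0 < (wordProduct u).trace := by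
  linarith [(dominatesOne_wordProduct u).two_le_trace]

lemma log_trace_nonneg (u : FiniteWord) : 0 ≤ Real.log (wordProduct u).trace :=
  Real.log_nonneg (by linarith [(dominatesOne_wordProduct u).two_le_trace])

/-- Testing on powers of the letters 0 and 1 gives nonnegativity at both endpoints. -/
lemma IsMajorant.nonneg {a b γ : ℝ} (h : IsMajorant a b) (h0 : 0 ≤ γ) (h1 : γ ≤ 1) :
    0 ≤ a * γ + b := by
  obtain ⟨C, hC⟩ := h
  have hb : -b ≤ 0 := nonpos_of_forall_nat_mul_le (C := C) fun n => by
    have k1 := hC (List.replicate n 0)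
    have k2 := log_trace_nonneg (List.replicate n 0)
    simp [ones, List.count_replicate] at k1
    linarith
  have hab : -(a + b) ≤ 0 := nonpos_of_forall_nat_mul_le (C := C) fun n => by
    have k1 := hC (List.replicate n 1)
    have k2 := log_trace_nonneg (List.replicate n 1)
    simp [ones] at k1
    linarith
  nlinarith

lemma growth_le {a b γ : ℝ} (h : IsMajorant a b) (h0 : 0 ≤ γ) (h1 : γ ≤ 1) :
    growth γ ≤ a * γ + b := by
  refine ciInf_le (f := fun c : {c : ℝ × ℝ // IsMajorant c.1 c.2} => c.1.1 * γ + c.1.2)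
    ⟨0, ?_⟩ ⟨(a, b), h⟩
  rintro _ ⟨c, rfl⟩
  exact c.2.nonneg h0 h1

/-- The generators applied to the positive vector (1, s) enlarge it at most by the factors 1 + s and
1 + 1/s. For small s the intercept log (1 + s) is small, which gives continuity of the growth
function at 0. -/
lemma isMajorant_weight {s : ℝ} (hs : 0 < s) :
    IsMajorant (Real.log (1 + 1 / s) - Real.log (1 + s)) (Real.log (1 + s)) := by
  set a := Real.log (1 + 1 / s) - Real.log (1 + s) with ha
  set b := Real.log (1 + s) with hb
  have hexpb : Real.exp b = 1 + s := Real.exp_log (by positivity)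
  have hexpab : Real.exp (a + b) = 1 + 1 / s := by
    rw [ha, sub_add_cancel]; exact Real.exp_log (by positivity)
  have key : ∀ u : FiniteWord,
      wordProduct u 0 0 + s * wordProduct u 0 1 ≤ Real.exp (a * ones u + b * u.length) ∧
      wordProduct u 1 0 + s * wordProduct u 1 1 ≤ s * Real.exp (a * ones u + b * u.length) := by
    intro u
    induction u with
    | nil => simp [wordProduct_nil, ones]
    | cons c u ih =>
      obtain ⟨i1, i2⟩ := ih
      obtain ⟨d1, d2, d3, d4⟩ := dominatesOne_wordProduct u
      have hs' : s * s⁻¹ = 1 := mul_inv_cancel₀ hs.ne'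
      have hsi : 0 < s⁻¹ := inv_pos.2 hs
      rw [wordProduct_cons, ones_cons, List.length_cons]
      set E := Real.exp (a * ones u + b * u.length) with hE
      fin_cases c
      · have e : Real.exp (a * ((0 + ones u : ℕ) : ℝ) + b * ((u.length + 1 : ℕ) : ℝ)) =
            E * (1 + s) := by
          rw [hE, ← hexpb, ← Real.exp_add]; congr 1; push_cast; ring
        simp only [Fin.zero_eta, e]
        simp only [matrixPair_one_zero, Matrix.mul_apply, Fin.sum_univ_two, Matrix.of_apply,
          Matrix.cons_val', Matrix.cons_val_zero, Matrix.cons_val_one, Matrix.cons_val_fin_one]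
        constructor
        · nlinarith [mul_nonneg hs.le (mul_nonneg hs.le d2)]
        · nlinarith [mul_nonneg hs.le (mul_nonneg hs.le (zero_le_one.trans d4))]
      · have e : Real.exp (a * ((1 + ones u : ℕ) : ℝ) + b * ((u.length + 1 : ℕ) : ℝ)) =
            E * (1 + s⁻¹) := by
          rw [hE, ← one_div, ← hexpab, ← Real.exp_add]; congr 1; push_cast; ring
        simp only [Fin.mk_one, e]
        simp only [matrixPair_one_one, Matrix.mul_apply, Fin.sum_univ_two, Matrix.of_apply,
          Matrix.cons_val', Matrix.cons_val_zero, Matrix.cons_val_one, Matrix.cons_val_fin_one]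
        constructor
        · have := mul_le_mul_of_nonneg_right i1 (by positivity : 0 ≤ 1 + s⁻¹)
          have e2 : (wordProduct u 0 0 + s * wordProduct u 0 1) * (1 + s⁻¹) =
            wordProduct u 0 0 + s * wordProduct u 0 1 + s⁻¹ * wordProduct u 0 0
              + wordProduct u 0 1 := by
            linear_combination wordProduct u 0 1 * hs'
          nlinarith [mul_nonneg hsi.le (zero_le_one.trans d1)]
        · have := mul_le_mul_of_nonneg_right i2 (by positivity : 0 ≤ 1 + s⁻¹)
          have e2 : (wordProduct u 1 0 + s * wordProduct u 1 1) * (1 + s⁻¹) =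
            wordProduct u 1 0 + s * wordProduct u 1 1 + s⁻¹ * wordProduct u 1 0
              + wordProduct u 1 1 := by
            linear_combination wordProduct u 1 1 * hs'
          nlinarith [mul_nonneg hsi.le d3]
  refine ⟨Real.log 2, fun u => ?_⟩
  obtain ⟨i1, i2⟩ := key u
  obtain ⟨d1, d2, d3, d4⟩ := dominatesOne_wordProduct u
  rw [← Real.log_exp (a * ones u + b * u.length), ← Real.log_mul (Real.exp_pos _).ne' two_ne_zero]
  refine Real.log_le_log (trace_wordProduct_pos u) ?_
  rw [Matrix.trace_fin_two]
  have h0 : wordProduct u 0 0 ≤ Real.exp (a * ones u + b * u.length) := by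
    nlinarith [mul_nonneg hs.le d2]
  have h1 : wordProduct u 1 1 ≤ Real.exp (a * ones u + b * u.length) := by
    refine le_of_mul_le_mul_left ?_ hs
    linarith
  linarith

lemma isMajorant_golden : IsMajorant 0 (Real.log ((1 + √5) / 2)) := by
  refine ⟨Real.log 2, fun u => ?_⟩
  have hφ : 0 < (1 + √5) / 2 := by positivity
  have h1 := euclideanNorm_prod_le u.reverse
  have h2 := trace_le_two_mul_euclideanNorm (wordProduct u)
  rw [List.length_reverse] at h1
  have h3 : (wordProduct u).trace ≤ 2 * ((1 + √5) / 2) ^ u.length :=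
    h2.trans (mul_le_mul_of_nonneg_left h1 zero_le_two)
  refine (Real.log_le_log (trace_wordProduct_pos u) h3).trans_eq ?_
  rw [Real.log_mul two_ne_zero (by positivity), Real.log_pow]
  ring

/-! ### The symmetry exchanging the two letters -/

lemma ones_map_rev (u : FiniteWord) : ones (u.map Fin.rev) + ones u = u.length := by
  induction u with
  | nil => simp [ones]
  | cons a u ih =>
    rw [List.map_cons, ones_cons, ones_cons, List.length_cons, ← ih]
    fin_cases a <;> simp <;> omega

/-- Exchanging the letters is conjugation by the permutation matrix, so traces are unchanged. -/
lemma wordProduct_map_rev (u : FiniteWord) : wordProduct (u.map Fin.rev) =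
    !![wordProduct u 1 1, wordProduct u 1 0; wordProduct u 0 1, wordProduct u 0 0] := by
  induction u with
  | nil => ext i j; fin_cases i <;> fin_cases j <;> simp [wordProduct_nil]
  | cons a u ih =>
    rw [List.map_cons, wordProduct_cons, ih, wordProduct_cons]
    fin_cases a <;> ext i j <;> fin_cases i <;> fin_cases j <;>
      simp [matrixPair_one_zero, matrixPair_one_one, Matrix.mul_apply, Fin.sum_univ_two] <;> ring

lemma IsMajorant.symm {a b : ℝ} (h : IsMajorant a b) : IsMajorant (-a) (a + b) := by
  obtain ⟨C, hC⟩ := h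
  refine ⟨C, fun u => ?_⟩
  have h1 := hC (u.map Fin.rev)
  have h2 : (wordProduct (u.map Fin.rev)).trace = (wordProduct u).trace := by
    rw [wordProduct_map_rev, Matrix.trace_fin_two, Matrix.trace_fin_two]; simp [add_comm]
  have h3 : (ones (u.map Fin.rev) : ℝ) = u.length - ones u := by
    rw [eq_sub_iff_add_eq]; exact_mod_cast ones_map_rev u
  rw [h2, h3, List.length_map] at h1
  linarith

/-! ### Concavity, symmetry and continuity of the growth function -/

instance : Nonempty {c : ℝ × ℝ // IsMajorant c.1 c.2} := ⟨⟨(_, _), isMajorant_golden⟩⟩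

lemma le_growth {γ t : ℝ} (h : ∀ a b, IsMajorant a b → t ≤ a * γ + b) : t ≤ growth γ :=
  le_ciInf fun c => h _ _ c.2

lemma exists_isMajorant_lt {γ t : ℝ} (h : growth γ < t) :
    ∃ a b, IsMajorant a b ∧ a * γ + b < t := by
  obtain ⟨c, hc⟩ := exists_lt_of_ciInf_lt h
  exact ⟨_, _, c.2, hc⟩

lemma growth_nonneg {γ : ℝ} (h0 : 0 ≤ γ) (h1 : γ ≤ 1) : 0 ≤ growth γ :=
  le_growth fun _ _ h => h.nonneg h0 h1

lemma concaveOn_growth : ConcaveOn ℝ (Set.Icc 0 1) growth := by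
  refine ⟨convex_Icc 0 1, fun x hx y hy s t hs ht hst => le_growth fun a b h => ?_⟩
  have h1 := mul_le_mul_of_nonneg_left (growth_le h hx.1 hx.2) hs
  have h2 := mul_le_mul_of_nonneg_left (growth_le h hy.1 hy.2) ht
  simp only [smul_eq_mul]
  linear_combination h1 + h2 + b * hst

lemma growth_symm {γ : ℝ} (hγ : γ ∈ Set.Icc (0 : ℝ) 1) : growth γ = growth (1 - γ) := by
  have key : ∀ t ∈ Set.Icc (0 : ℝ) 1, growth t ≤ growth (1 - t) := fun t ht =>
    le_growth fun a b h => by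
      have := growth_le h.symm ht.1 ht.2
      linarith
  refine le_antisymm (key γ hγ) ?_
  have := key (1 - γ) ⟨by linarith [hγ.2], by linarith [hγ.1]⟩
  rwa [sub_sub_cancel] at this

lemma tendsto_growth_zero : Tendsto growth (nhdsWithin 0 (Set.Ici 0)) (nhds 0) := by
  have hIcc : ∀ᶠ γ in nhdsWithin (0 : ℝ) (Set.Ici 0), γ ∈ Set.Icc (0 : ℝ) 1 :=
    Icc_mem_nhdsGE zero_lt_one
  rw [tendsto_order]
  constructor
  · intro t ht
    filter_upwards [hIcc] with γ hγ
    exact ht.trans_le (growth_nonneg hγ.1 hγ.2)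
  · intro t ht
    -- This weight s makes the intercept log (1 + s) equal to t / 2.
    have hs : 0 < Real.exp (t / 2) - 1 := by
      have := Real.add_one_lt_exp (x := t / 2) (by linarith)
      linarith
    have hmaj := isMajorant_weight hs
    rw [add_sub_cancel, Real.log_exp] at hmaj
    set a := Real.log (1 + 1 / (Real.exp (t / 2) - 1)) - t / 2
    have hlim : Tendsto (fun γ => a * γ + t / 2) (nhdsWithin 0 (Set.Ici 0)) (nhds (t / 2)) := by
      have : ContinuousAt (fun γ : ℝ => a * γ + t / 2) 0 := by fun_prop
      have h2 := this.tendsto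
      simp only [mul_zero, zero_add] at h2
      exact h2.mono_left nhdsWithin_le_nhds
    filter_upwards [hIcc, hlim.eventually_lt_const (by linarith : t / 2 < t)] with γ hγ hlt
    exact (growth_le hmaj hγ.1 hγ.2).trans_lt hlt

lemma growth_zero : growth 0 = 0 := by
  have h : pure (0 : ℝ) ≤ nhdsWithin (0 : ℝ) (Set.Ici 0) := pure_le_nhdsWithin (by simp)
  exact tendsto_nhds_unique (tendsto_pure_nhds growth 0) (tendsto_growth_zero.mono_left h)

lemma growth_one : growth 1 = 0 := by
  rw [growth_symm ⟨zero_le_one, le_rfl⟩, sub_self, growth_zero]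

lemma continuousOn_growth : ContinuousOn growth (Set.Icc 0 1) := by
  have h0 : ContinuousWithinAt growth (Set.Ici 0) 0 := by
    rw [ContinuousWithinAt, growth_zero]; exact tendsto_growth_zero
  refine concaveOn_growth.continuousOn_Icc zero_lt_one h0 ?_
  have hmap : Tendsto (fun γ : ℝ => 1 - γ) (nhdsWithin 1 (Set.Iic 1))
      (nhdsWithin 0 (Set.Ici 0)) := by
    refine tendsto_nhdsWithin_iff.2 ⟨?_, ?_⟩
    · have : ContinuousAt (fun γ : ℝ => 1 - γ) 1 := by fun_prop
      have h2 := this.tendsto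
      simp only [sub_self] at h2
      exact h2.mono_left nhdsWithin_le_nhds
    · filter_upwards [self_mem_nhdsWithin] with γ hγ
      exact sub_nonneg.2 (Set.mem_Iic.1 hγ)
  rw [ContinuousWithinAt, growth_one]
  refine (tendsto_growth_zero.comp hmap).congr' ?_
  filter_upwards [Icc_mem_nhdsLE (zero_lt_one' ℝ)] with γ hγ
  exact (growth_symm hγ).symm

lemma growth_le_golden {γ : ℝ} (hγ : γ ∈ Set.Icc (0 : ℝ) 1) :
    growth γ ≤ Real.log ((1 + √5) / 2) := by
  simpa using growth_le isMajorant_golden hγ.1 hγ.2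

/-- The point y lies between x and 1 - x, where the function takes equal values; concavity does the
rest. -/
lemma monotoneOn_growth : MonotoneOn growth (Set.Icc 0 (1 / 2)) := by
  intro x hx y hy hxy
  have hx1 : x ∈ Set.Icc (0 : ℝ) 1 := ⟨hx.1, by linarith [hx.2]⟩
  have hx2 : 1 - x ∈ Set.Icc (0 : ℝ) 1 := ⟨by linarith [hx.2], by linarith [hx.1]⟩
  have := concaveOn_growth.ge_on_segment hx1 hx2 (z := y) (by
    rw [segment_eq_Icc (by linarith [hx.2])]
    exact ⟨hxy, by linarith [hx.2, hy.2]⟩)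
  rwa [← growth_symm hx1, min_self] at this

/-! ### The growth function at rational points -/

/-- Applying the majorant to powers of u makes the additive constant negligible. -/
lemma IsMajorant.log_specRadius_le {a b : ℝ} (h : IsMajorant a b) (u : FiniteWord) :
    Real.log (specRadius (wordProduct u)) ≤ a * ones u + b * u.length := by
  obtain ⟨C, hC⟩ := h
  have hR := one_le_specRadius_wordProduct u
  rw [← sub_nonpos]
  refine nonpos_of_forall_nat_mul_le (C := C) fun n => ?_
  have h1 := hC (List.replicate n u).flatten
  rw [wordProduct_flatten_replicate, ones_flatten_replicate] at h1
  have h2 := Real.log_le_log (by positivity) (specRadius_pow_le_trace u n)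
  rw [Real.log_pow] at h2
  simp at h1
  linarith

lemma IsMajorant.log_entrySum_le {a b : ℝ} (h : IsMajorant a b) :
    ∃ C, ∀ u : FiniteWord,
      Real.log (entrySum (wordProduct u)) ≤ a * ones u + b * u.length + C := by
  obtain ⟨C, hC⟩ := h
  refine ⟨a + b * 2 + C, fun u => ?_⟩
  have h1 := hC ([0, 1] ++ u)
  have h2 : entrySum (wordProduct u) ≤ (wordProduct ([0, 1] ++ u)).trace := by
    rw [wordProduct_append]
    exact (dominatesOne_wordProduct u).entrySum_le_trace_mul wordProduct_zero_one_ge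
  have h3 := Real.log_le_log (by linarith [(dominatesOne_wordProduct u).one_le_entrySum]) h2
  have h4 : ones [0, 1] = 1 := by decide
  rw [ones_append, h4, List.length_append] at h1
  push_cast [List.length_cons, List.length_nil] at h1
  linarith

lemma le_growth_of_mem_X {p q : ℕ} (hq : 0 < q) {x : InfiniteWord}
    (hx : x ∈ X ((p : ℝ) / q)) :
    (q : ℝ)⁻¹ * Real.log (specRadius (cocycle x q)) ≤ growth ((p : ℝ) / q) := by
  refine le_growth fun a b h => ?_
  have h1 := h.log_specRadius_le (initialWord q x)
  have h2 : cnt x q = p := by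
    have := win_eq_of_mem_X hq hx 0
    simpa [win, cnt_zero] using this
  rw [ones_initialWord, initialWord_length, h2] at h1
  have hq' : (0 : ℝ) < q := by exact_mod_cast hq
  rw [inv_mul_le_iff₀ hq', cocycle]
  have : (q : ℝ) * (a * (p / q) + b) = a * p + b * q := by field_simp
  rw [this]; exact h1

/-- Separation in the plane: the hypothesis says that every ratio l/k with k > 0 lies below every
such ratio with k < 0. The supremum of the former is a valid slope. -/
lemma exists_slope {W : Type*} {l k : W → ℝ}
    (h : ∀ u v, 0 < k u → k v < 0 → l u * -k v + l v * k u ≤ 0) (h0 : ∀ u, k u = 0 → l u ≤ 0)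
    (hpos : ∃ u, 0 < k u) (hneg : ∃ v, k v < 0) : ∃ a, ∀ u, l u ≤ a * k u := by
  have hle : ∀ u v, 0 < k u → k v < 0 → l u / k u ≤ l v / k v := by
    intro u v hu hv
    rw [div_le_iff₀ hu, div_mul_eq_mul_div, le_div_iff_of_neg hv]
    linarith [h u v hu hv]
  set T := {t | ∃ u, 0 < k u ∧ t = l u / k u} with hT
  have hne : T.Nonempty := hpos.imp' (fun u => l u / k u) fun u hu => ⟨u, hu, rfl⟩
  have hub : ∀ v, k v < 0 → l v / k v ∈ upperBounds T := by
    rintro v hv _ ⟨u, hu, rfl⟩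
    exact hle u v hu hv
  refine ⟨sSup T, fun u => ?_⟩
  rcases lt_trichotomy (k u) 0 with hu | hu | hu
  · exact (le_div_iff_of_neg hu).1 (csSup_le hne (hub u hu))
  · rw [hu, mul_zero]; exact h0 u hu
  · obtain ⟨v, hv⟩ := hneg
    exact (div_le_iff₀ hu).1 (le_csSup ⟨_, hub v hv⟩ ⟨u, hu, rfl⟩)

/-- The concatenation of the words of a list, each of them preceded by `01`. -/
def separatedConcat (L : List FiniteWord) : FiniteWord := (L.map fun u => [0, 1] ++ u).flatten

lemma separatedConcat_cons (u : FiniteWord) (L : List FiniteWord) :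
    separatedConcat (u :: L) = [0, 1] ++ (u ++ separatedConcat L) := by
  simp [separatedConcat]

/-- Entry sums are supermultiplicative across the connector 01; z is the accumulator of the
induction. -/
lemma prod_entrySum_mul_le (L : List FiniteWord) (z : FiniteWord) :
    (L.map fun u => entrySum (wordProduct u)).prod * entrySum (wordProduct z) ≤
      entrySum (wordProduct (z ++ separatedConcat L)) := by
  induction L generalizing z with
  | nil => simp [separatedConcat]
  | cons u L ih =>
    have h1 := (dominatesOne_wordProduct u).entrySum_mul_entrySum_le
      (dominatesOne_wordProduct z) wordProduct_zero_one_ge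
    have h2 := ih (z ++ ([0, 1] ++ u))
    rw [wordProduct_append, wordProduct_append, List.append_assoc, List.append_assoc] at h2
    rw [separatedConcat_cons, List.map_cons, List.prod_cons]
    refine le_trans ?_ h2
    have h3 : 0 ≤ (L.map fun u => entrySum (wordProduct u)).prod := by
      refine List.prod_nonneg fun t ht => ?_
      obtain ⟨w, -, rfl⟩ := List.mem_map.1 ht
      exact zero_le_one.trans (dominatesOne_wordProduct w).one_le_entrySum
    calc _ = (L.map fun u => entrySum (wordProduct u)).prod *
          (entrySum (wordProduct u) * entrySum (wordProduct z)) := by ring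
      _ ≤ _ := mul_le_mul_of_nonneg_left h1 h3

lemma prod_entrySum_le_trace (L : List FiniteWord) :
    (L.map fun u => entrySum (wordProduct u)).prod ≤
      (wordProduct (separatedConcat L)).trace := by
  cases L with
  | nil => simp [separatedConcat, wordProduct_nil]
  | cons u L =>
    rw [separatedConcat_cons, wordProduct_append]
    refine le_trans ?_ ((dominatesOne_wordProduct _).entrySum_le_trace_mul wordProduct_zero_one_ge)
    rw [List.map_cons, List.prod_cons, mul_comm]
    exact prod_entrySum_mul_le L u

lemma length_separatedConcat (L : List FiniteWord) :
    (separatedConcat L).length = (L.map fun u => u.length + 2).sum := by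
  induction L with
  | nil => rfl
  | cons u L ih =>
    rw [separatedConcat_cons, List.length_append, List.length_append, ih, List.map_cons,
      List.sum_cons]
    simp; ring

lemma ones_separatedConcat (L : List FiniteWord) :
    ones (separatedConcat L) = (L.map fun u => ones u + 1).sum := by
  induction L with
  | nil => rfl
  | cons u L ih =>
    rw [separatedConcat_cons, ones_append, ones_append, ih, List.map_cons, List.sum_cons]
    have h4 : ones [0, 1] = 1 := by decide
    omega

lemma cocycle_mul_period {x : InfiniteWord} {q : ℕ} (hper : ∀ i, x (i + q) = x i) (M : ℕ) :
    cocycle x (q * M) = cocycle x q ^ M := by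
  have hs : shift q x = x := by funext i; rw [shift, add_comm, hper]
  induction M with
  | zero => simp [cocycle, initialWord, wordProduct_nil]
  | succ M ih =>
    rw [mul_add, mul_one, add_comm, cocycle, initialWord_add, hs, wordProduct_append, pow_succ,
      ← ih]
    rfl

/-- The balanced competitor of the same length is the M-th power of one period, with trace at most
twice the M-th power of the spectral radius. -/
lemma log_trace_le_of_ones_mul_eq {p q : ℕ} (hq : 0 < q) {x : InfiniteWord}
    (hx : x ∈ X ((p : ℝ) / q)) {w : FiniteWord} {M : ℕ} (hwl : w.length = q * M)
    (hwo : ones w = p * M) :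
    Real.log (wordProduct w).trace ≤
      (q : ℝ)⁻¹ * Real.log (specRadius (cocycle x q)) * w.length + Real.log 2 := by
  have hq' : (q : ℝ) ≠ 0 := by positivity
  rcases Nat.eq_zero_or_pos M with rfl | hM
  · have : w = [] := List.eq_nil_of_length_eq_zero (by simpa using hwl)
    subst this
    simp [wordProduct_nil]
  have hM' : (M : ℝ) ≠ 0 := by positivity
  have hx' : x ∈ X (((p * M : ℕ) : ℝ) / (q * M : ℕ)) := by
    have : ((p * M : ℕ) : ℝ) / (q * M : ℕ) = p / q := by push_cast; field_simp
    rwa [this]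
  have h1 := trace_le_trace_cocycle (Nat.mul_pos hq hM) hwl hwo hx'
  rw [cocycle_mul_period (letter_add_eq_of_mem_X hq hx)] at h1
  have h2 := h1.trans (trace_pow_le_two_mul_specRadius_pow (initialWord q x) M)
  have hR := one_le_specRadius_wordProduct (initialWord q x)
  refine (Real.log_le_log (trace_wordProduct_pos w) h2).trans_eq ?_
  rw [Real.log_mul two_ne_zero (by positivity), Real.log_pow, hwl, cocycle]
  push_cast
  field_simp
  ring

/-- The value of the growth function at a rational point. -/
theorem growth_eq_of_mem_X {p q : ℕ} (hq : 0 < q) (hpq : p ≤ q) {x : InfiniteWord}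
    (hx : x ∈ X ((p : ℝ) / q)) :
    growth ((p : ℝ) / q) = (q : ℝ)⁻¹ * Real.log (specRadius (cocycle x q)) := by
  have hq' : (0 : ℝ) < q := by exact_mod_cast hq
  have hle := le_growth_of_mem_X hq hx
  have hR : 0 ≤ (q : ℝ)⁻¹ * Real.log (specRadius (cocycle x q)) :=
    mul_nonneg (by positivity) (Real.log_nonneg (one_le_specRadius_wordProduct _))
  refine le_antisymm ?_ hle
  -- At the endpoints k below would not take both signs, so they are treated apart.
  rcases Nat.eq_zero_or_pos p with rfl | hp
  · rw [Nat.cast_zero, zero_div, growth_zero]; exact hR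
  rcases hpq.eq_or_lt with rfl | hlt
  · rw [div_self hq'.ne', growth_one]; exact hR
  set σ := (q : ℝ)⁻¹ * Real.log (specRadius (cocycle x q)) with hσ
  -- The shifts by 1 and 2 account for the connector 01 placed before each word: k measures the
  -- deviation from slope p/q, and l the excess over rate σ.
  set k : FiniteWord → ℤ := fun u => q * (ones u + 1) - p * (u.length + 2) with hk
  set l : FiniteWord → ℝ := fun u => Real.log (entrySum (wordProduct u)) - σ * (u.length + 2)
    with hl
  -- Repeating the words q·m and q·n times makes the length a multiple of q and the slope exactly
  -- p/q, so the maximality bound applies.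
  have hcomb : ∀ (u v : FiniteWord) (m n : ℕ), m * k u + n * k v = 0 →
      q * m * l u + q * n * l v ≤ Real.log 2 := by
    intro u v m n hmn
    set L : List FiniteWord := List.replicate (q * m) u ++ List.replicate (q * n) v with hL
    have hlen : (separatedConcat L).length = q * (m * (u.length + 2) + n * (v.length + 2)) := by
      rw [length_separatedConcat, hL]; simp; ring
    have hones : ones (separatedConcat L) = p * (m * (u.length + 2) + n * (v.length + 2)) := by
      rw [ones_separatedConcat, hL]; simp
      zify
      simp only [hk] at hmn
      linear_combination hmn
    have h1 := log_trace_le_of_ones_mul_eq hq hx hlen hones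
    have hu := (dominatesOne_wordProduct u).one_le_entrySum
    have hv := (dominatesOne_wordProduct v).one_le_entrySum
    have h2 := prod_entrySum_le_trace L
    have h3 : (L.map fun u => entrySum (wordProduct u)).prod =
        entrySum (wordProduct u) ^ (q * m) * entrySum (wordProduct v) ^ (q * n) := by
      rw [hL]; simp
    rw [h3] at h2
    have h4 := Real.log_le_log (by positivity) h2
    rw [Real.log_mul (by positivity) (by positivity), Real.log_pow, Real.log_pow] at h4
    rw [hlen] at h1
    push_cast at h1 h4
    simp only [hl]
    linear_combination h1 + h4
  obtain ⟨a, ha⟩ : ∃ a : ℝ, ∀ u, l u ≤ a * (k u : ℝ) := by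
    refine exists_slope (fun u v hu hv => ?_) (fun u hu => ?_)
      ⟨List.replicate (2 * q) 1, ?_⟩ ⟨List.replicate (2 * q) 0, ?_⟩
    · have hu' : 0 < k u := by exact_mod_cast hu
      have hv' : k v < 0 := by exact_mod_cast hv
      refine nonpos_of_forall_nat_mul_le (C := Real.log 2) fun n => ?_
      have h1 := hcomb u v (n * (-k v).toNat) (n * (k u).toNat) (by
        push_cast
        rw [Int.toNat_of_nonneg (by linarith), Int.toNat_of_nonneg hu'.le]; ring)
      have e1 : ((-k v).toNat : ℝ) = -(k v : ℝ) := by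
        exact_mod_cast Int.toNat_of_nonneg (by linarith : 0 ≤ -k v)
      have e2 : ((k u).toNat : ℝ) = (k u : ℝ) := by
        exact_mod_cast Int.toNat_of_nonneg hu'.le
      push_cast at h1
      rw [e1, e2] at h1
      have e3 : (q : ℝ) * (n * -(k v : ℝ)) * l u + q * (n * (k u : ℝ)) * l v =
        q * (n * (l u * -(k v : ℝ) + l v * k u)) := by ring
      rw [e3] at h1
      have hq1 : (1 : ℝ) ≤ q := by exact_mod_cast hq
      have hlog : 0 ≤ Real.log 2 := Real.log_nonneg one_le_two
      by_contra! hc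
      nlinarith
    · refine nonpos_of_forall_nat_mul_le (C := Real.log 2) fun n => ?_
      have hu' : k u = 0 := by exact_mod_cast hu
      have h1 := hcomb u u n 0 (by rw [hu']; simp)
      simp at h1
      have hq1 : (1 : ℝ) ≤ q := by exact_mod_cast hq
      have hlog : 0 ≤ Real.log 2 := Real.log_nonneg one_le_two
      by_contra! hc
      nlinarith
    · have : 0 < k (List.replicate (2 * q) 1) := by
        simp only [hk, ones]
        simp
        have h1 : (p : ℤ) + 1 ≤ q := by exact_mod_cast hlt
        have h2 : (0 : ℤ) < q := by exact_mod_cast hq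
        nlinarith
      exact_mod_cast this
    · have : k (List.replicate (2 * q) 0) < 0 := by
        simp only [hk, ones]
        simp [List.count_replicate]
        have h1 : (0 : ℤ) < p := by exact_mod_cast hp
        have h2 : (0 : ℤ) < q := by exact_mod_cast hq
        nlinarith
      exact_mod_cast this
  -- This line takes the value σ at p/q.
  have hmaj : IsMajorant (a * q) (σ - a * p) := by
    refine ⟨2 * σ + a * (q - 2 * p), fun u => ?_⟩
    have h1 := Real.log_le_log (trace_wordProduct_pos u)
      (dominatesOne_wordProduct u).trace_le_entrySum
    have h2 := ha u
    simp only [hl, hk] at h2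
    push_cast at h2
    linarith
  refine (growth_le hmaj (by positivity) ?_).trans_eq ?_
  · rw [div_le_one hq']; exact_mod_cast hpq
  · field_simp; ring

/-! ### Uniform growth rates -/

lemma one_le_euclideanNorm_wordProduct (u : FiniteWord) : 1 ≤ euclideanNorm (wordProduct u) := by
  linarith [trace_le_two_mul_euclideanNorm (wordProduct u),
    (dominatesOne_wordProduct u).two_le_trace]

/-- Take a majorant with value below t at γ; discrepancy at most 1 costs only |a|, uniformly in x
and n. -/
lemma log_euclideanNorm_cocycle_le {γ t : ℝ} (ht : growth γ < t) :
    ∃ C, ∀ x ∈ X γ, ∀ n : ℕ, Real.log (euclideanNorm (cocycle x n)) ≤ n * t + C := by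
  obtain ⟨a, b, hab, hlt⟩ := exists_isMajorant_lt ht
  obtain ⟨C, hC⟩ := hab.log_entrySum_le
  refine ⟨|a| + C, fun x hx n => ?_⟩
  have h1 := hC (initialWord n x)
  rw [ones_initialWord, initialWord_length] at h1
  have h2 := Real.log_le_log (by linarith [one_le_euclideanNorm_wordProduct (initialWord n x)])
    (euclideanNorm_le_entrySum (dominatesOne_wordProduct (initialWord n x)))
  have h3 : a * ((cnt x n : ℝ) - n * γ) ≤ |a| := by
    refine (le_abs_self _).trans ?_
    rw [abs_mul]
    exact mul_le_of_le_one_right (abs_nonneg _) ((hasSlope_of_mem_X hx).abs_cnt_sub_le n)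
  have h4 : (n : ℝ) * (a * γ + b) ≤ n * t := mul_le_mul_of_nonneg_left hlt.le (by positivity)
  rw [cocycle]
  linarith

lemma log_trace_le_log_specRadius (u : FiniteWord) :
    Real.log (wordProduct u).trace - Real.log 2 ≤ Real.log (specRadius (wordProduct u)) := by
  have h1 := Real.log_le_log (trace_wordProduct_pos u) (trace_le_two_mul_specRadius u)
  have h2 := one_le_specRadius_wordProduct u
  rw [Real.log_mul two_ne_zero (by positivity)] at h1
  linarith

/-- Keep the complete periods: dropping the remaining letters cannot raise the trace. -/
lemma le_log_specRadius_cocycle_of_rat {p q : ℕ} (hq : 0 < q) (hpq : p ≤ q) :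
    ∃ C, ∀ x ∈ X ((p : ℝ) / q), ∀ n : ℕ,
      n * growth ((p : ℝ) / q) - C ≤ Real.log (specRadius (cocycle x n)) := by
  refine ⟨q * growth ((p : ℝ) / q) + Real.log 2, fun x hx n => ?_⟩
  have hq' : (0 : ℝ) < q := by exact_mod_cast hq
  have hS : 0 ≤ growth ((p : ℝ) / q) :=
    growth_nonneg (by positivity) (by rw [div_le_one hq']; exact_mod_cast hpq)
  have hn : q * (n / q) + n % q = n := Nat.div_add_mod n q
  have h1 : specRadius (cocycle x q) ^ (n / q) ≤ (cocycle x n).trace := by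
    refine (specRadius_pow_le_trace (initialWord q x) (n / q)).trans ?_
    have e := cocycle_mul_period (letter_add_eq_of_mem_X hq hx) (n / q)
    rw [cocycle, cocycle] at e
    rw [← e, cocycle, ← hn, initialWord_add, wordProduct_append, hn]
    exact (dominatesOne_wordProduct _).trace_le_trace_mul (dominatesOne_wordProduct _)
  have hR := one_le_specRadius_wordProduct (initialWord q x)
  have h2 := Real.log_le_log (by rw [cocycle]; positivity) h1
  rw [Real.log_pow] at h2
  have h3 : Real.log (specRadius (cocycle x q)) = q * growth ((p : ℝ) / q) := by
    rw [growth_eq_of_mem_X hq hpq hx]; field_simp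
  have h4 := log_trace_le_log_specRadius (initialWord n x)
  rw [h3] at h2
  have h5 : (n : ℝ) ≤ q * ((n / q : ℕ) + 1) := by
    exact_mod_cast (Nat.lt_mul_div_succ n hq).le
  have h6 := mul_le_mul_of_nonneg_right h5 hS
  rw [cocycle] at h2 ⊢
  linarith

/-! ### Irrational slopes: blocks of nearby rational slope joined by connectors -/

lemma HasSlope.exists_length_mem {γ : ℝ} (h0 : 0 < γ) (h1 : γ < 1) :
    ∃ L, 0 < L ∧ ∀ x, HasSlope γ x → 0 ∈ initialWord L x ∧ 1 ∈ initialWord L x := by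
  -- With this L the expected number of each letter exceeds the discrepancy 1.
  obtain ⟨L, hL⟩ := exists_nat_gt (max (1 / γ) (1 / (1 - γ)))
  refine ⟨L, ?_, fun x hx => ?_⟩
  · have : 0 < 1 / γ := by positivity
    exact_mod_cast this.trans ((le_max_left _ _).trans_lt hL)
  have hL0 : 1 < L * γ := by
    rw [← div_lt_iff₀ h0]; exact (le_max_left _ _).trans_lt hL
  have hL1 : 1 < L * (1 - γ) := by
    rw [← div_lt_iff₀ (by linarith)]; exact (le_max_right _ _).trans_lt hL
  have h2 := abs_le.1 (hx.abs_cnt_sub_le L)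
  rw [← ones_initialWord] at h2
  constructor
  · by_contra hne
    have : ones (initialWord L x) = L := by
      have h3 : ones (initialWord L x) = (initialWord L x).length := by
        refine List.count_eq_length.2 fun b hb => ?_
        by_contra hb1
        have : b = 0 := by omega
        exact hne (this ▸ hb)
      rwa [initialWord_length] at h3
    rw [this] at h2
    linarith
  · have : (0 : ℝ) < ones (initialWord L x) := by linarith
    exact List.count_pos_iff.1 (by exact_mod_cast this)

/-- Dirichlet approximation at a level n so large that no denominator up to D is good enough;
denominator at most n gives the last inequality. -/
lemma exists_rat_approx {γ : ℝ} (hγ : Irrational γ) (D : ℕ) {δ : ℝ} (hδ : 0 < δ) :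
    ∃ r : ℚ, D < r.den ∧ |γ - r| < δ ∧ |r.den * γ - r.num| * (r.den - 1) < 1 := by
  have hev : ∀ᶠ n : ℕ in atTop, (1 / ((n : ℝ) + 1) < δ) ∧
      ∀ d ∈ Finset.Icc 1 D, 1 / ((n : ℝ) + 1) < |d * γ - round (d * γ)| := by
    have hlim := tendsto_one_div_add_atTop_nhds_zero_nat (𝕜 := ℝ)
    refine (hlim.eventually_lt_const hδ).and ((Finset.eventually_all _).2 fun d hd => ?_)
    refine hlim.eventually_lt_const (abs_pos.2 ?_)
    have hd0 : d ≠ 0 := by have := Finset.mem_Icc.1 hd; omega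
    exact ((hγ.natCast_mul hd0).ne_int _) |> sub_ne_zero.2
  obtain ⟨n, ⟨hn1, hn2⟩, hn0⟩ := (hev.and (eventually_gt_atTop 0)).exists
  obtain ⟨r, hr, hrn⟩ := Real.exists_rat_abs_sub_le_and_den_le γ hn0
  have hden : (0 : ℝ) < r.den := by exact_mod_cast r.den_pos
  have hden1 : (1 : ℝ) ≤ r.den := by exact_mod_cast r.den_pos
  have hn' : (0 : ℝ) < (n : ℝ) + 1 := by positivity
  have hrr : (r : ℝ) = r.num / r.den := by exact_mod_cast (Rat.num_div_den r).symm
  have h1 : |r.den * γ - r.num| ≤ 1 / ((n : ℝ) + 1) := by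
    have e : (r.den * γ - r.num : ℝ) = r.den * (γ - r) := by rw [hrr]; field_simp
    rw [e, abs_mul, Nat.abs_cast]
    calc (r.den : ℝ) * |γ - r| ≤ r.den * (1 / ((n + 1) * r.den)) :=
          mul_le_mul_of_nonneg_left hr hden.le
      _ = _ := by field_simp
  refine ⟨r, ?_, ?_, ?_⟩
  · by_contra! hle
    have h2 := hn2 r.den (Finset.mem_Icc.2 ⟨r.den_pos, hle⟩)
    exact absurd (h1.trans_lt h2) (not_lt.2 (round_le _ _))
  · refine lt_of_le_of_lt (hr.trans ?_) hn1
    exact one_div_le_one_div_of_le hn' (le_mul_of_one_le_right hn'.le hden1)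
  · have h2 : (r.den : ℝ) - 1 < n + 1 := by
      have : (r.den : ℝ) ≤ n := by exact_mod_cast hrn
      linarith
    calc _ ≤ 1 / ((n : ℝ) + 1) * (r.den - 1) :=
          mul_le_mul_of_nonneg_right h1 (by linarith)
      _ < 1 := by rw [one_div, inv_mul_lt_iff₀ hn']; linarith

/-- Concatenating blocks separated by words containing both letters. -/
lemma pow_le_trace_cocycle {γ Q : ℝ} {l L : ℕ} (hQ0 : 0 ≤ Q)
    (hL : ∀ x, HasSlope γ x → 0 ∈ initialWord L x ∧ 1 ∈ initialWord L x)
    (hQ : ∀ x, HasSlope γ x → Q ≤ entrySum (wordProduct (initialWord l x)))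
    {x : InfiniteWord} (hx : HasSlope γ x) (j s : ℕ) :
    Q ^ j ≤ (cocycle x (L + ((l + L) * j + s))).trace := by
  have hC : ∀ y, HasSlope γ y → ∀ a b, 1 ≤ wordProduct (initialWord L y) a b := fun y hy =>
    one_le_wordProduct_of_mem (hL y hy).1 (hL y hy).2
  have key : ∀ (j : ℕ) (y : InfiniteWord), HasSlope γ y →
      Q ^ j ≤ entrySum (wordProduct (initialWord ((l + L) * j) y)) := by
    intro j
    induction j with
    | zero => intro y _; simpa using (dominatesOne_wordProduct _).one_le_entrySum
    | succ j ih =>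
      intro y hy
      rw [mul_add, mul_one, add_comm _ (l + L), initialWord_add, initialWord_add,
        wordProduct_append, wordProduct_append, ← mul_assoc, pow_succ]
      refine le_trans ?_ ((dominatesOne_wordProduct _).entrySum_mul_entrySum_le
        (dominatesOne_wordProduct _) (hC _ (hy.shift l)))
      exact mul_le_mul (ih _ (hy.shift _)) (hQ y hy) hQ0
        (zero_le_one.trans (dominatesOne_wordProduct _).one_le_entrySum)
  rw [cocycle, ← add_assoc, initialWord_add, wordProduct_append]
  refine le_trans ?_ ((dominatesOne_wordProduct _).trace_le_trace_mul (dominatesOne_wordProduct _))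
  rw [initialWord_add, wordProduct_append]
  exact (key j _ (hx.shift L)).trans
    ((dominatesOne_wordProduct _).entrySum_le_trace_mul (hC x hx))

/-- The block of length q - 1 is a mechanical period without its last letter, and restoring that
letter at most doubles the entry sum. -/
lemma le_entrySum_of_hasSlope {γ : ℝ} {p q : ℕ} (hq : 0 < q) (hpq : p ≤ q)
    (hcop : Nat.Coprime p q) (hγ : |q * γ - p| * (q - 1) < 1) {x : InfiniteWord}
    (hx : HasSlope γ x) :
    Real.exp (q * growth ((p : ℝ) / q)) / 2 ≤ entrySum (wordProduct (initialWord (q - 1) x)) := by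
  obtain ⟨k, hk⟩ := exists_eq_mech hx hq hpq hcop hγ
  set y := shift k (mech p q) with hy
  have hyX : y ∈ X ((p : ℝ) / q) := shift_mem_X_of_periodic hq (mech_mem_X hq hpq) k
  have hxy : initialWord (q - 1) x = initialWord (q - 1) y := initialWord_congr hk
  have hq' : (q : ℝ) ≠ 0 := by positivity
  have hR := one_le_specRadius_wordProduct (initialWord q y)
  have h1 : Real.exp (q * growth ((p : ℝ) / q)) = specRadius (wordProduct (initialWord q y)) := by
    rw [growth_eq_of_mem_X hq hpq hyX, mul_inv_cancel_left₀ hq', cocycle,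
      Real.exp_log (by positivity)]
  have h2 := specRadius_le_trace (initialWord q y)
  have h3 := (dominatesOne_wordProduct (initialWord q y)).trace_le_entrySum
  have h4 := entrySum_wordProduct_append_singleton_le (initialWord (q - 1) y) (y (q - 1))
  rw [← initialWord_succ, Nat.sub_add_cancel hq] at h4
  rw [h1, hxy]
  linarith

lemma le_log_specRadius_cocycle {γ t : ℝ} (hγ : γ ∈ Set.Icc (0 : ℝ) 1) (ht : t < growth γ) :
    ∃ C, ∀ x ∈ X γ, ∀ n : ℕ, n * t - C ≤ Real.log (specRadius (cocycle x n)) := by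
  by_cases hirr : Irrational γ
  swap
  · obtain ⟨r, rfl⟩ : γ ∈ Set.range ((↑) : ℚ → ℝ) := by
      by_contra h; exact hirr h
    have hr0 : 0 ≤ r.num := Rat.num_nonneg.2 (by exact_mod_cast hγ.1)
    have hnum : ((r.num.toNat : ℕ) : ℤ) = r.num := Int.toNat_of_nonneg hr0
    have hr : (r : ℝ) = (r.num.toNat : ℝ) / r.den := by
      have h1 : ((r.num.toNat : ℕ) : ℝ) = ((r.num : ℤ) : ℝ) := by
        rw [← Int.cast_natCast, hnum]
      rw [h1]; exact_mod_cast (Rat.num_div_den r).symm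
    have hden : (0 : ℝ) < r.den := by exact_mod_cast r.den_pos
    have hle : r.num.toNat ≤ r.den := by
      have := hγ.2
      rw [hr, div_le_one hden] at this
      exact_mod_cast this
    rw [hr] at ht ⊢
    obtain ⟨C, hC⟩ := le_log_specRadius_cocycle_of_rat r.den_pos hle
    refine ⟨C, fun x hx n => le_trans ?_ (hC x hx n)⟩
    have := mul_le_mul_of_nonneg_left ht.le (Nat.cast_nonneg (α := ℝ) n)
    linarith
  rcases lt_or_ge t 0 with ht0 | ht0
  · refine ⟨0, fun x _ n => ?_⟩
    have h1 := Real.log_nonneg (one_le_specRadius_wordProduct (initialWord n x))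
    have h2 := mul_nonneg (Nat.cast_nonneg (α := ℝ) n) (neg_nonneg.2 ht0.le)
    rw [cocycle]; linarith
  have h0 : 0 < γ := lt_of_le_of_ne hγ.1 (by simpa using (hirr.ne_int 0).symm)
  have h1 : γ < 1 := lt_of_le_of_ne hγ.2 (by simpa using hirr.ne_int 1)
  obtain ⟨L, hL0, hL⟩ := HasSlope.exists_length_mem h0 h1
  obtain ⟨t', htt', ht'⟩ := exists_between ht
  obtain ⟨δ, hδ, hδS⟩ : ∃ δ > 0, ∀ r : ℝ, |γ - r| < δ → r ∈ Set.Icc (0 : ℝ) 1 ∧ t' < growth r := by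
    have hnhds := Icc_mem_nhds h0 h1
    have hcont := (continuousOn_growth.continuousAt hnhds).eventually_const_lt ht'
    obtain ⟨δ, hδ, h⟩ := Metric.eventually_nhds_iff.1 (hcont.and hnhds)
    refine ⟨δ, hδ, fun r hr => ?_⟩
    have := h (y := r) (by rwa [dist_comm, Real.dist_eq])
    exact ⟨this.2, this.1⟩
  -- For q > D the gain q (t' - t) of a block pays for the factor 1/2 and for a connector of length
  -- L.
  obtain ⟨D, hD⟩ := exists_nat_gt ((Real.log 2 + L * t) / (t' - t))
  rw [div_lt_iff₀ (by linarith)] at hD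
  obtain ⟨r, hrD, hrδ, hrγ⟩ := exists_rat_approx hirr D hδ
  obtain ⟨hrIcc, hrS⟩ := hδS r hrδ
  obtain ⟨p, q, hq, hcop, hnum, hden⟩ : ∃ p q : ℕ, 0 < q ∧ Nat.Coprime p q ∧
      (r.num : ℝ) = p ∧ r.den = q := by
    have hr0 : 0 ≤ r.num := Rat.num_nonneg.2 (by exact_mod_cast hrIcc.1)
    refine ⟨r.num.natAbs, r.den, r.den_pos, r.reduced, ?_, rfl⟩
    rw [Nat.cast_natAbs, abs_of_nonneg hr0]
  have hr : (r : ℝ) = p / q := by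
    rw [← hnum, ← hden]; exact_mod_cast (Rat.num_div_den r).symm
  have hq' : (0 : ℝ) < q := by exact_mod_cast hq
  have hpq : p ≤ q := by
    have := hrIcc.2
    rw [hr, div_le_one hq'] at this
    exact_mod_cast this
  rw [hnum, hden] at hrγ
  rw [hden] at hrD
  rw [hr] at hrS
  set Q := Real.exp (q * growth ((p : ℝ) / q)) / 2 with hQdef
  have hQpos : 0 < Q := by positivity
  have hlogQ : ((q - 1 + L : ℕ) : ℝ) * t ≤ Real.log Q := by
    rw [hQdef, Real.log_div (Real.exp_pos _).ne' two_ne_zero, Real.log_exp]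
    have e1 : ((q - 1 + L : ℕ) : ℝ) ≤ q + L := by exact_mod_cast (by omega : q - 1 + L ≤ q + L)
    have e2 := mul_le_mul_of_nonneg_right e1 ht0
    have e3 : (D : ℝ) ≤ q := by exact_mod_cast hrD.le
    have e4 := mul_le_mul_of_nonneg_right e3 (by linarith : 0 ≤ t' - t)
    have e5 := mul_le_mul_of_nonneg_left hrS.le hq'.le
    linarith
  have hblock : ∀ y, HasSlope γ y → Q ≤ entrySum (wordProduct (initialWord (q - 1) y)) :=
    fun y hy => le_entrySum_of_hasSlope hq hpq hcop hrγ hy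
  have hm : 0 < q - 1 + L := by omega
  refine ⟨((L + (q - 1 + L) : ℕ) : ℝ) * t + Real.log 2, fun x hx n => ?_⟩
  have hxS := hasSlope_of_mem_X hx
  have h4 := log_trace_le_log_specRadius (initialWord n x)
  rcases Nat.lt_or_ge n L with hnL | hnL
  · have e1 : (n : ℝ) ≤ ((L + (q - 1 + L) : ℕ) : ℝ) := by
      exact_mod_cast (by omega : n ≤ L + (q - 1 + L))
    have e2 := mul_le_mul_of_nonneg_right e1 ht0
    have e3 := log_trace_nonneg (initialWord n x)
    rw [cocycle]; linarith
  obtain ⟨n', rfl⟩ := Nat.exists_eq_add_of_le hnL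
  have hdm := Nat.div_add_mod n' (q - 1 + L)
  have h5 := pow_le_trace_cocycle hQpos.le hL hblock hxS (n' / (q - 1 + L)) (n' % (q - 1 + L))
  rw [hdm] at h5
  have h6 := Real.log_le_log (by positivity) h5
  rw [Real.log_pow] at h6
  have h7 := mul_le_mul_of_nonneg_left hlogQ (Nat.cast_nonneg (α := ℝ) (n' / (q - 1 + L)))
  have h8 : (n' : ℝ) ≤ ((q - 1 + L : ℕ) : ℝ) * ((n' / (q - 1 + L) : ℕ) + 1) := by
    exact_mod_cast (Nat.lt_mul_div_succ n' hm).le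
  have h9 := mul_le_mul_of_nonneg_right h8 ht0
  rw [cocycle] at h6 ⊢
  push_cast at h7 h9 ⊢
  linarith

theorem tendstoUniformlyOn_growth {γ : ℝ} (hγ : γ ∈ Set.Icc (0 : ℝ) 1) :
    TendstoUniformlyOn (fun (n : ℕ) (x : InfiniteWord) =>
        1 / (n : ℝ) * Real.log (euclideanNorm (cocycle x n))) (fun _ => growth γ) atTop (X γ) ∧
      TendstoUniformlyOn (fun (n : ℕ) (x : InfiniteWord) =>
        1 / (n : ℝ) * Real.log (specRadius (cocycle x n))) (fun _ => growth γ) atTop (X γ) := by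
  -- The log norm and the log spectral radius agree up to log 2 in the needed directions, so one
  -- sandwich serves both limits.
  have key : ∀ f : ℕ → InfiniteWord → ℝ,
      (∀ n x, Real.log (specRadius (cocycle x n)) - Real.log 2 ≤ f n x) →
      (∀ n x, f n x ≤ Real.log (euclideanNorm (cocycle x n)) + Real.log 2) →
      TendstoUniformlyOn (fun (n : ℕ) x => 1 / (n : ℝ) * f n x) (fun _ => growth γ)
        atTop (X γ) := by
    intro f hf1 hf2
    rw [Metric.tendstoUniformlyOn_iff]
    intro ε hε
    obtain ⟨C₁, hC₁⟩ := le_log_specRadius_cocycle hγ (sub_lt_self (growth γ) (half_pos hε))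
    obtain ⟨C₂, hC₂⟩ := log_euclideanNorm_cocycle_le (lt_add_of_pos_right (growth γ) (half_pos hε))
    obtain ⟨N, hN⟩ := exists_nat_gt (max (C₁ + Real.log 2) (C₂ + Real.log 2) / (ε / 2))
    rw [div_lt_iff₀ (half_pos hε)] at hN
    filter_upwards [eventually_ge_atTop N, eventually_gt_atTop 0] with n hn hn0 x hx
    have hn0' : (0 : ℝ) < n := by exact_mod_cast hn0
    have hnN : (N : ℝ) ≤ n := by exact_mod_cast hn
    have e1 := hC₁ x hx n
    have e2 := hC₂ x hx n
    have e3 := hf1 n x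
    have e4 := hf2 n x
    have e5 := mul_le_mul_of_nonneg_right hnN (half_pos hε).le
    have e6 := max_lt_iff.1 hN
    rw [dist_comm, Real.dist_eq]
    have e7 : 1 / (n : ℝ) * f n x - growth γ = (f n x - n * growth γ) / n := by field_simp
    rw [e7, abs_div, abs_of_pos hn0', div_lt_iff₀ hn0', abs_lt]
    constructor <;> linarith [e6.1, e6.2]
  have hlog2 : 0 ≤ Real.log 2 := Real.log_nonneg one_le_two
  have hle : ∀ n x, Real.log (specRadius (cocycle x n)) ≤
      Real.log (euclideanNorm (cocycle x n)) + Real.log 2 := by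
    intro n x
    have h1 := one_le_specRadius_wordProduct (initialWord n x)
    have h2 := one_le_euclideanNorm_wordProduct (initialWord n x)
    rw [cocycle, ← Real.log_mul (by positivity) two_ne_zero]
    refine Real.log_le_log (by positivity) ?_
    linarith [specRadius_le_trace (initialWord n x),
      trace_le_two_mul_euclideanNorm (wordProduct (initialWord n x))]
  exact ⟨key _ (fun n x => by linarith [hle n x]) (fun n x => by linarith),
    key _ (fun n x => by linarith) hle⟩

/-! ### The joint spectral radius -/

lemma growth_half : growth (1 / 2) = Real.log ((1 + √5) / 2) := by
  have hX := mech_mem_X (p := 1) (q := 2) two_pos one_le_two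
  have h := growth_eq_of_mem_X two_pos one_le_two hX
  rw [Nat.cast_one, Nat.cast_ofNat] at h
  have hc : cocycle (mech 1 2) 2 = wordProduct [0, 1] := by
    simp [cocycle, initialWord, mech]
  have h5 : √5 ^ 2 = 5 := Real.sq_sqrt (by norm_num)
  have h5' : 0 ≤ √5 := Real.sqrt_nonneg 5
  -- The product has trace 3, the sum of the square of the golden ratio and its inverse.
  have hR : specRadius (wordProduct [0, 1]) = ((1 + √5) / 2) ^ 2 := by
    refine specRadius_of_add_inv_eq_trace (det_wordProduct _) ?_ ?_
    · nlinarith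
    · have e : (((1 + √5) / 2) ^ 2)⁻¹ = (3 - √5) / 2 := by
        refine inv_eq_of_mul_eq_one_right ?_
        linear_combination (1 / 8 - √5 / 8) * h5
      have e2 : ((1 + √5) / 2) ^ 2 = (3 + √5) / 2 := by linear_combination 1 / 4 * h5
      rw [e, e2, wordProduct_cons, wordProduct_singleton, matrixPair_one_zero, matrixPair_one_one,
        Matrix.trace_fin_two]
      simp [Matrix.mul_apply, Fin.sum_univ_two]
      ring
  rw [h, hc, hR, Real.log_pow]
  push_cast
  ring

/-- Submultiplicativity bounds the maximum above by the golden ratio, and the alternating word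
bounds it below, so the sequence actually converges. -/
lemma rhoPair_one : rhoPair 1 = (1 + √5) / 2 := by
  have hφ : 0 < (1 + √5) / 2 := by positivity
  rw [rhoPair, jointSpectralRadius]
  refine Tendsto.limsup_eq ?_
  have hX := mech_mem_X (p := 1) (q := 2) two_pos one_le_two
  rw [Nat.cast_one, Nat.cast_ofNat] at hX
  have hlim : Tendsto (fun n : ℕ => euclideanNorm (cocycle (mech 1 2) n) ^ (1 / (n : ℝ))) atTop
      (nhds ((1 + √5) / 2)) := by
    have h1 := ((tendstoUniformlyOn_growth (γ := 1 / 2) ⟨by norm_num, by norm_num⟩).1).tendsto_at hX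
    have h2 := (Real.continuous_exp.tendsto _).comp h1
    rw [growth_half, Real.exp_log hφ] at h2
    refine h2.congr fun n => ?_
    have h3 : 0 < euclideanNorm (cocycle (mech 1 2) n) :=
      zero_lt_one.trans_le (one_le_euclideanNorm_wordProduct _)
    rw [Real.rpow_def_of_pos h3, Function.comp_apply, mul_comm]
  refine tendsto_of_tendsto_of_tendsto_of_le_of_le' hlim tendsto_const_nhds ?_ ?_
  · refine Eventually.of_forall fun n => ?_
    -- The cocycle multiplies letters from right to left, whence the reversal.
    set l := (initialWord n (mech 1 2)).reverse with hl
    have hlen : l.length = n := by rw [hl, List.length_reverse, initialWord_length]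
    have hof : List.ofFn (fun i : Fin n => l.get (i.cast hlen.symm)) = l := by
      refine List.ext_getElem (by simp [hlen]) fun i h1 h2 => by simp
    have := le_ciSup (f := fun i : Fin n → Fin 2 =>
      euclideanNorm ((List.ofFn i).map (matrixPair 1)).prod ^ (1 / (n : ℝ)))
      (Set.finite_range _).bddAbove (fun i : Fin n => l.get (i.cast hlen.symm))
    simp only [hof] at this
    exact this
  · filter_upwards [eventually_gt_atTop 0] with n hn
    refine ciSup_le fun i => ?_
    have h1 := euclideanNorm_prod_le (List.ofFn i)
    rw [List.length_ofFn] at h1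
    have h2 := Real.rpow_le_rpow (norm_nonneg _) h1 (by positivity : 0 ≤ 1 / (n : ℝ))
    rwa [one_div, Real.pow_rpow_inv_natCast hφ.le hn.ne', ← one_div] at h2

end BalancedProducts

theorem mainTheorem3 :
    ∃ S : ℝ → ℝ,
      ContinuousOn S (Set.Icc 0 1) ∧
      ConcaveOn ℝ (Set.Icc 0 1) S ∧
      (∀ γ ∈ Set.Icc (0 : ℝ) 1,
        TendstoUniformlyOn
          (fun (n : ℕ) (x : BalancedProducts.InfiniteWord) =>
            1 / (n : ℝ) * Real.log (BalancedProducts.euclideanNorm (BalancedProducts.cocycle x n)))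
          (fun _ => S γ) Filter.atTop (BalancedProducts.X γ) ∧
        TendstoUniformlyOn
          (fun (n : ℕ) (x : BalancedProducts.InfiniteWord) =>
            1 / (n : ℝ) * Real.log (BalancedProducts.specRadius (BalancedProducts.cocycle x n)))
          (fun _ => S γ) Filter.atTop (BalancedProducts.X γ)) ∧
      (∀ p q : ℕ, 0 < q → p ≤ q →
        ∀ x ∈ BalancedProducts.X ((p : ℝ) / (q : ℝ)),
          S ((p : ℝ) / (q : ℝ)) =
            (q : ℝ)⁻¹ * Real.log (BalancedProducts.specRadius (BalancedProducts.cocycle x q))) ∧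
      S 0 = 0 ∧ S 1 = 0 ∧ IsGLB (S '' Set.Icc 0 1) 0 ∧
      IsLUB (S '' Set.Icc 0 1) (S (1 / 2)) ∧
      S (1 / 2) = Real.log ((1 + Real.sqrt 5) / 2) ∧
      S (1 / 2) = Real.log (BalancedProducts.rhoPair 1) ∧
      (∀ γ ∈ Set.Icc (0 : ℝ) 1, S γ = S (1 - γ)) ∧
      MonotoneOn S (Set.Icc 0 (1 / 2)) := by
  open BalancedProducts in
  refine ⟨growth, continuousOn_growth, concaveOn_growth, fun γ hγ => tendstoUniformlyOn_growth hγ,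
    fun p q hq hpq x hx => growth_eq_of_mem_X hq hpq hx, growth_zero, growth_one,
    IsLeast.isGLB ⟨⟨0, by simp, growth_zero⟩, ?_⟩,
    IsGreatest.isLUB ⟨⟨1 / 2, by norm_num, rfl⟩, ?_⟩, growth_half, ?_,
    fun γ hγ => growth_symm hγ, monotoneOn_growth⟩
  · rintro _ ⟨γ, hγ, rfl⟩
    exact growth_nonneg hγ.1 hγ.2
  · rintro _ ⟨γ, hγ, rfl⟩
    rw [growth_half]; exact growth_le_golden hγ
  · rw [growth_half, rhoPair_one]
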